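/- Corollary 4.3. **Setting.** There are $K\ge 1$ independent streams $X_k=(X_k(n))_{n\ge 1}$, $k\in[K]$. Stream $k$ has law $\mathrm P_k^1$ if it is a signal and $\mathrm P_k^0$ if it is noise; $\mathrm P_A$ is the joint (product) law, and $\mathrm E_A$ the expectation, when $A\subseteq[K]$ is the set of signals. Let $\mathcal F_k(n)=\sigma(X_k(1),\dots,X_k(n))$ and $\mathcal F(n)=\sigma(\mathcal F_k(n),\,k\in[K])$. A sequential multiple testing procedure is $\chi=(T_k,D_k)_{k\in[K]}$, where $T_k\in\{1,2,\dots\}\cup\{\infty\}$ is a stopping time of $(\mathcal F(n))_n$ and $D_k\in\{0,1\}$ is an $\mathcal F(T_k)$-measurable decision ($D_k=1$: stream $k$ is identified as a signal). It is synchronous if $T_1=\dots=T_K$. For integers $0\le l\le u\le K$ with $u>0$ and $l<K$, let $\Pi_{l,u}=\{A\subseteq[K]: l\le|A|\le u\}$. For $\alpha,\beta\in(0,1)$ let $\Delta(\alpha,\beta)$ be the family of procedures such that, for every $A\in\Pi_{l,u}$, $\mathrm P_A(T_k<\infty)=1$ for all $k$, $\mathrm P_A(\exists j\notin A: D_j=1)\le\alpha$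 and $\mathrm P_A(\exists i\in A: D_i=0)\le\beta$. Let $$\mathcal L_{k,A}(\alpha,\beta)=\inf\{\mathrm E_A[T_k]:\chi\in\Delta(\alpha,\beta)\},\qquad \mathcal L''_A(\alpha,\beta)=\inf\{\mathrm E_A[T_1]:\chi\in\Delta(\alpha,\beta),\ \chi\text{ synchronous}\},$$ and let $\mathrm{ARE}''_{k,A}(l,u)$ denote the limit of $\mathcal L_{k,A}(\alpha,\beta)/\mathcal L''_A(\alpha,\beta)$ as $\alpha,\beta\to0$ in the regime considered. **Assumptions.** For every $k$ and $n\ge1$, $\mathrm P_k^0$ and $\mathrm P_k^1$ are mutually absolutely continuous on $\mathcal F_k(n)$, with log-likelihood ratio $\lambda_k(n)=\log\frac{d\mathrm P_k^1}{d\mathrm P_k^0}(\mathcal F_k(n))$. For every $k$ there are numbers $I_k,J_k>0$ with $$\mathrm P_k^1\Big(\limsup_n \tfrac{\lambda_k(n)}n\le I_k\Big)=1,\qquad \mathrm P_k^0\Big(\limsup_n \tfrac{-\lambda_k(n)}n\le J_k\Big)=1,$$ and, for every $\epsilon>0$, $$\sum_{n\ge1}\mathrm P_k^1\Big(\tfrac{\lambda_k(n)}n\le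 I_k-\epsilon\Big)<\infty,\qquad \sum_{n\ge1}\mathrm P_k^0\Big(\tfrac{-\lambda_k(n)}n\le J_k-\epsilon\Big)<\infty.$$ **Conclusion.** Let $A\in\Pi_{l,u}$, $\mathcal I_A=\min_{i\in A}I_i$, $\mathcal J_A=\min_{j\notin A}J_j$, where the minimum over the empty set is $\infty$ (with $\infty\cdot0=0$ and $c/\infty=0$ for $0\le c<\infty$). The limits below exist and satisfy the following. (i) If $\alpha,\beta\to0$ so that $|\log\alpha|/|\log\beta|\to0$, then $$\mathrm{ARE}''_{i,A}(l,u)=0\ \text{ for every } i\in A, \text{ provided that } A\ne[K],\qquad \mathrm{ARE}''_{j,A}(l,u)=\frac{\mathcal J_A+\mathcal I_A\mathbf 1\{|A|=u\}}{J_j+\mathcal I_A\mathbf 1\{|A|=u\}}\ \text{ for every } j\notin A.$$ (ii) If $\alpha,\beta\to0$ so that $|\log\beta|/|\log\alpha|\to0$, then $$\mathrm{ARE}''_{i,A}(l,u)=\frac{\mathcal I_A+\mathcal J_A\mathbf 1\{|A|=l\}}{I_i+\mathcal J_A\mathbf 1\{|A|=l\}}\ \text{ for every } i\in A,\qquad \mathrm{ARE}''_{j,A}(l,u)=0\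 \text{ for every } j\notin A, \text{ provided that } A\ne\emptyset.$$ (iii) If $r>0$ and $\alpha,\beta\to0$ so that $|\log\alpha|/(r|\log\beta|)\to1$, then, with $$M=\max\Big\{\frac{r}{\mathcal I_A+\mathcal J_A\mathbf 1\{|A|=l\}},\ \frac{1}{\mathcal J_A+\mathcal I_A\mathbf 1\{|A|=u\}}\Big\},$$ $$\mathrm{ARE}''_{i,A}(l,u)=\frac{r/(I_i+\mathcal J_A\mathbf 1\{|A|=l\})}{M}\ \text{ for every } i\in A,\qquad \mathrm{ARE}''_{j,A}(l,u)=\frac{1/(J_j+\mathcal I_A\mathbf 1\{|A|=u\})}{M}\ \text{ for every } j\notin A.$$ -/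

import Mathlib

open MeasureTheory Filter Topology
open scoped ENNReal

noncomputable section

namespace SeqMultTest

/-- The sigma-algebra, on the space of paths of one stream, generated by the first `n` observations.
The `t`-th observation (`t = 1, 2, …`) of a path `x` is `x (t - 1)`. -/
@[reducible] def pathSigma (S : Type*) [MeasurableSpace S] (n : ℕ) : MeasurableSpace (ℕ → S) :=
  ⨆ (t : ℕ) (_ : t < n), MeasurableSpace.comap (fun x : ℕ → S => x t) inferInstance

theorem pathSigma_le (S : Type*) [MeasurableSpace S] (n : ℕ) :
    pathSigma S n ≤ (MeasurableSpace.pi : MeasurableSpace (ℕ → S)) :=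
  iSup₂_le fun t _ => (measurable_pi_apply t).comap_le

theorem pathSigma_mono (S : Type*) [MeasurableSpace S] : Monotone (pathSigma S) :=
  fun _ _ hmn => iSup₂_le fun t ht =>
    le_iSup₂_of_le t (lt_of_lt_of_le ht hmn) le_rfl

/-- The space of all observations in all `K` streams. -/
abbrev Obs {K : ℕ} (E : Fin K → Type*) : Type _ := (k : Fin K) → ℕ → E k

/-- The filtration `ℱ(n) = σ(ℱ_k(n), k ∈ [K])` generated by all the streams. -/
def obsFiltration {K : ℕ} (E : Fin K → Type*) [∀ k, MeasurableSpace (E k)] :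
    Filtration ℕ (inferInstance : MeasurableSpace (Obs E)) where
  seq n := ⨆ k : Fin K, MeasurableSpace.comap (fun ω : Obs E => ω k) (pathSigma (E k) n)
  mono' := fun _ _ hmn => iSup_mono fun k => MeasurableSpace.comap_mono (pathSigma_mono (E k) hmn)
  le' := fun n => iSup_le fun k =>
    (MeasurableSpace.comap_mono (pathSigma_le (E k) n)).trans (measurable_pi_apply k).comap_le

/-- A sequential multiple testing procedure: stream `k` is decided at the stopping time `T k`
(a positive, possibly infinite, integer) and identified as a signal iff `D k = true`,
where `D k` is `ℱ(T k)`-measurable. -/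
structure Procedure {K : ℕ} (E : Fin K → Type*) [∀ k, MeasurableSpace (E k)] where
  T : Fin K → Obs E → ℕ∞
  D : Fin K → Obs E → Bool
  one_le_T : ∀ k ω, 1 ≤ T k ω
  isStoppingTime_T : ∀ k, IsStoppingTime (obsFiltration E) (T k)
  measurable_D : ∀ k, Measurable (D k)
  measurableSet_D : ∀ (k : Fin K) (n : ℕ) (b : Bool),
    MeasurableSet[obsFiltration E n] {ω | T k ω = (n : ℕ∞) ∧ D k ω = b}

/-- All the decisions are made at the same time. -/
def Procedure.IsSynchronous {K : ℕ} {E : Fin K → Type*} [∀ k, MeasurableSpace (E k)]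
    (χ : Procedure E) : Prop :=
  ∀ k k' : Fin K, χ.T k = χ.T k'

/-- The joint law `P_A` of the independent streams when the subset of signals is `A`. -/
def jointLaw {K : ℕ} {E : Fin K → Type*} [∀ k, MeasurableSpace (E k)]
    (P0 P1 : (k : Fin K) → Measure (ℕ → E k)) (A : Finset (Fin K)) : Measure (Obs E) :=
  Measure.pi fun k => if k ∈ A then P1 k else P0 k

/-- The class `Π_{l,u}` of the subsets whose size is between `l` and `u`. -/
def sizeClass (K l u : ℕ) : Set (Finset (Fin K)) := {A | l ≤ A.card ∧ A.card ≤ u}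

section Optimal

variable {K : ℕ} {E : Fin K → Type*} [∀ k, MeasurableSpace (E k)]
  (P0 P1 : (k : Fin K) → Measure (ℕ → E k))

/-- Type-I familywise error rate: some noise stream is identified as a signal. -/
def FWE1 (A : Finset (Fin K)) (χ : Procedure E) : ℝ≥0∞ :=
  jointLaw P0 P1 A {ω | ∃ j, j ∉ A ∧ χ.D j ω = true}

/-- Type-II familywise error rate: some signal stream is identified as noise. -/
def FWE2 (A : Finset (Fin K)) (χ : Procedure E) : ℝ≥0∞ :=
  jointLaw P0 P1 A {ω | ∃ i, i ∈ A ∧ χ.D i ω = false}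

/-- The family `Δ(α, β, Π)`: the procedures that, for every subset of signals in the class `C`,
terminate almost surely in every stream and have familywise error rates at most `α` and `β`. -/
def controlled (α β : ℝ) (C : Set (Finset (Fin K))) : Set (Procedure E) :=
  {χ | ∀ A ∈ C, (∀ k, ∀ᵐ ω ∂(jointLaw P0 P1 A), χ.T k ω ≠ ⊤) ∧
    FWE1 P0 P1 A χ ≤ ENNReal.ofReal α ∧ FWE2 P0 P1 A χ ≤ ENNReal.ofReal β}

/-- The expected decision time `E_A[T_k]`. -/
def expTime (A : Finset (Fin K)) (χ : Procedure E) (k : Fin K) : ℝ≥0∞ :=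
  ∫⁻ ω, (χ.T k ω : ℝ≥0∞) ∂(jointLaw P0 P1 A)

/-- `ℒ_{k,A}(α, β, Π)`: the optimal expected decision time in stream `k`. -/
def optTime (k : Fin K) (A : Finset (Fin K)) (α β : ℝ) (C : Set (Finset (Fin K))) : ℝ≥0∞ :=
  ⨅ χ ∈ controlled P0 P1 α β C, expTime P0 P1 A χ k

/-- `ℒ''_A(α, β, Π)`: the optimal expected decision time among synchronous procedures. -/
def optTimeSync [NeZero K] (A : Finset (Fin K)) (α β : ℝ) (C : Set (Finset (Fin K))) : ℝ≥0∞ :=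
  ⨅ χ ∈ controlled P0 P1 α β C ∩ {χ | χ.IsSynchronous}, expTime P0 P1 A χ 0

/-- The relative efficiency of the synchronous family in stream `k`, whose limit is
`ARE''_{k,A}(l, u)`. -/
def relEffSync [NeZero K] (l u : ℕ) (k : Fin K) (A : Finset (Fin K)) (α β : ℝ) : ℝ≥0∞ :=
  optTime P0 P1 k A α β (sizeClass K l u) / optTimeSync P0 P1 A α β (sizeClass K l u)

end Optimal

section Distribution

variable {S : Type*} [MeasurableSpace S]

/-- The restrictions of the two laws to the first `n` observations are mutually absolutely
continuous, for every `n ≥ 1`. -/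
def LocallyEquivalent (Q0 Q1 : Measure (ℕ → S)) : Prop :=
  ∀ n : ℕ, 1 ≤ n →
    Q1.trim (pathSigma_le S n) ≪ Q0.trim (pathSigma_le S n) ∧
    Q0.trim (pathSigma_le S n) ≪ Q1.trim (pathSigma_le S n)

/-- The log-likelihood ratio `λ(n) = log (dQ1 / dQ0)` of the first `n` observations. -/
def logLR (Q0 Q1 : Measure (ℕ → S)) (n : ℕ) : (ℕ → S) → ℝ :=
  llr (Q1.trim (pathSigma_le S n)) (Q0.trim (pathSigma_le S n))

/-- `Q(limsup_n ξ(n)/n ≤ c) = 1`, the upper limit being taken in the extended reals. -/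
def LimsupRateLE {Ω : Type*} [MeasurableSpace Ω] (Q : Measure Ω) (ξ : ℕ → Ω → ℝ) (c : ℝ) : Prop :=
  ∀ᵐ x ∂Q, limsup (fun n : ℕ => ((ξ n x / (n : ℝ) : ℝ) : EReal)) atTop ≤ (c : EReal)

/-- `∑_{n ≥ 1} Q(ξ(n)/n ≤ c - ε) < ∞` for every `ε > 0`. -/
def CompleteRateGE {Ω : Type*} [MeasurableSpace Ω] (Q : Measure Ω) (ξ : ℕ → Ω → ℝ) (c : ℝ) :
    Prop :=
  ∀ ε : ℝ, 0 < ε → ∑' n : ℕ, Q {x | ξ (n + 1) x / ((n + 1 : ℕ) : ℝ) ≤ c - ε} < ∞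

end Distribution

/-- The minimum of `f` over `s`, which is `∞` when `s` is empty. -/
def minOver {K : ℕ} (f : Fin K → ℝ) (s : Finset (Fin K)) : ℝ≥0∞ := ⨅ k ∈ s, ENNReal.ofReal (f k)

/-- `x + 𝒥_A · 1{|A| = l}`, where `𝒥_A` is the minimum of `J` over the noise streams. -/
def signalRate {K : ℕ} (J : Fin K → ℝ) (l : ℕ) (A : Finset (Fin K)) (x : ℝ≥0∞) : ℝ≥0∞ :=
  x + if A.card = l then minOver J Aᶜ else 0

/-- `x + ℐ_A · 1{|A| = u}`, where `ℐ_A` is the minimum of `I` over the signal streams. -/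
def noiseRate {K : ℕ} (I : Fin K → ℝ) (u : ℕ) (A : Finset (Fin K)) (x : ℝ≥0∞) : ℝ≥0∞ :=
  x + if A.card = u then minOver I A else 0

end SeqMultTest

end

/-! Write `R(A, B)` for the sum of the rates of the streams in which `A` and `B` differ; it is the
growth rate of the log-likelihood ratio of `P_A` against `P_B` under `P_A`.

If stream `k` has opposite roles under `A` and `B`, a procedure that controls the errors under both
cannot decide it much before the likelihood ratio reaches the inverse of the relevant level, hence
not before `|log α| / R(A, B)` if `k ∈ A` and `|log β| / R(A, B)` otherwise. Conversely, waiting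
until some member of the class beats every such `B` at once attains the maximum of these bounds
over `B`, and waiting for this in all the streams attains the maximum over `k` as well.

For a class given by the number of signals, the alternative closest to `A` flips stream `k` alone
or, when this leaves the class, together with the least informative stream of the opposite role. -/

namespace SeqMultTest

open scoped symmDiff

theorem measure_eq_setLIntegral_exp_llr_trim {Ω : Type*} {m m0 : MeasurableSpace Ω} (hm : m ≤ m0)
    {μ ν : Measure Ω} [IsFiniteMeasure μ] [IsFiniteMeasure ν]
    (hμν : μ.trim hm ≪ ν.trim hm) (hνμ : ν.trim hm ≪ μ.trim hm)
    {s : Set Ω} (hs : MeasurableSet[m] s) :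
    μ s = ∫⁻ x in s, ENNReal.ofReal (Real.exp (llr (μ.trim hm) (ν.trim hm) x)) ∂ν := by
  have hmeas : Measurable[m] fun x =>
      ENNReal.ofReal (Real.exp (llr (μ.trim hm) (ν.trim hm) x)) :=
    (measurable_llr _ _).exp.ennreal_ofReal
  rw [← setLIntegral_trim hm hmeas hs, ← trim_measurableSet_eq hm hs,
    ← Measure.setLIntegral_rnDeriv hμν s]
  refine lintegral_congr_ae (ae_restrict_of_ae ?_)
  filter_upwards [exp_llr_of_ac' _ _ hνμ, Measure.rnDeriv_lt_top (μ.trim hm) (ν.trim hm)]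
    with x hexp hfin
  rw [hexp, ENNReal.ofReal_toReal hfin.ne]

theorem measure_eq_setLIntegral_exp_neg_llr_trim {Ω : Type*} {m m0 : MeasurableSpace Ω}
    (hm : m ≤ m0) {μ ν : Measure Ω} [IsFiniteMeasure μ] [IsFiniteMeasure ν]
    (hμν : μ.trim hm ≪ ν.trim hm) (hνμ : ν.trim hm ≪ μ.trim hm)
    {s : Set Ω} (hs : MeasurableSet[m] s) :
    ν s = ∫⁻ x in s, ENNReal.ofReal (Real.exp (-llr (μ.trim hm) (ν.trim hm) x)) ∂μ := by
  rw [measure_eq_setLIntegral_exp_llr_trim hm hνμ hμν hs]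
  refine lintegral_congr_ae (ae_restrict_of_ae ?_)
  filter_upwards [ae_eq_of_ae_eq_trim (neg_llr hμν)] with x hx
  rw [← hx, Pi.neg_apply]

theorem lintegral_pi_prod_comp {ι : Type*} [Fintype ι] {X : ι → Type*}
    [∀ i, MeasurableSpace (X i)] (μ : ∀ i, Measure (X i)) [∀ i, IsProbabilityMeasure (μ i)]
    {f : ∀ i, X i → ℝ≥0∞} (hf : ∀ i, Measurable (f i)) :
    ∫⁻ x, ∏ i, f i (x i) ∂(Measure.pi μ) = ∏ i, ∫⁻ y, f i y ∂(μ i) := by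
  have hind := ProbabilityTheory.iIndepFun_pi (μ := μ) (X := f) (fun i => (hf i).aemeasurable)
  rw [ProbabilityTheory.lintegral_prod_eq_prod_lintegral_of_indepFun Finset.univ _ hind
    (fun i => (hf i).comp (measurable_pi_apply i))]
  exact Finset.prod_congr rfl fun i _ => (measurePreserving_eval μ i).lintegral_comp (hf i)

theorem indicator_univ_pi_prod {ι : Type*} [Fintype ι] {X : ι → Type*}
    (t : ∀ i, Set (X i)) (f : ∀ i, X i → ℝ≥0∞) (x : ∀ i, X i) :
    (Set.univ.pi t).indicator (fun x => ∏ i, f i (x i)) x = ∏ i, (t i).indicator (f i) (x i) := by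
  by_cases h : x ∈ Set.univ.pi t
  · rw [Set.indicator_of_mem h]
    exact Finset.prod_congr rfl fun i _ => (Set.indicator_of_mem (h i trivial) _).symm
  · rw [Set.indicator_of_notMem h]
    obtain ⟨i, hi⟩ : ∃ i, x i ∉ t i := by simpa using h
    exact (Finset.prod_eq_zero (Finset.mem_univ i) (Set.indicator_of_notMem hi _)).symm

theorem pi_apply_eq_setLIntegral_prod {ι : Type*} [Fintype ι] {X : ι → Type*}
    {m m0 : ∀ i, MeasurableSpace (X i)} (hm : ∀ i, m i ≤ m0 i) (μ ν : ∀ i, Measure (X i))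
    [∀ i, IsProbabilityMeasure (μ i)] [∀ i, IsProbabilityMeasure (ν i)]
    {f : ∀ i, X i → ℝ≥0∞} (hf : ∀ i, Measurable (f i))
    (h : ∀ i s, MeasurableSet[m i] s → μ i s = ∫⁻ x in s, f i x ∂(ν i))
    {s : Set (∀ i, X i)} (hs : MeasurableSet[@MeasurableSpace.pi _ _ m] s) :
    Measure.pi μ s = ∫⁻ x in s, ∏ i, f i (x i) ∂(Measure.pi ν) := by
  have hpi : @MeasurableSpace.pi _ _ m ≤ MeasurableSpace.pi :=
    iSup_mono fun i => MeasurableSpace.comap_mono (hm i)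
  rw [← withDensity_apply _ (hpi _ hs)]
  have hrect : ∀ s ∈ Set.pi Set.univ '' Set.pi Set.univ fun i => {t | MeasurableSet[m i] t},
      Measure.pi μ s = (Measure.pi ν).withDensity (fun x => ∏ i, f i (x i)) s := by
    rintro _ ⟨t, ht, rfl⟩
    have htm (i : ι) : MeasurableSet (t i) := hm i _ (ht i trivial)
    rw [withDensity_apply _ (MeasurableSet.univ_pi htm),
      ← lintegral_indicator (MeasurableSet.univ_pi htm)]
    simp only [indicator_univ_pi_prod]
    rw [Measure.pi_pi, lintegral_pi_prod_comp _ fun i => (hf i).indicator (htm i)]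
    exact Finset.prod_congr rfl fun i _ => by
      rw [h i _ (ht i trivial), lintegral_indicator (htm i)]
  refine ext_on_measurableSpace_of_generate_finite _ _ hrect hpi
    (@generateFrom_pi _ _ _ m).symm (@isPiSystem_pi _ _ m) (hrect _ ⟨fun _ => Set.univ, ?_⟩) hs
  simp

theorem measure_iUnion_le_mul {Ω : Type*} {m : MeasurableSpace Ω} (f : Filtration ℕ m)
    {μ ν : Measure Ω} {c : ℝ≥0∞} {s : ℕ → Set Ω} (hs : ∀ n, MeasurableSet[f n] (s n))
    (h : ∀ n t, MeasurableSet[f n] t → t ⊆ s n → μ t ≤ c * ν t) :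
    μ (⋃ n, s n) ≤ c * ν (⋃ n, s n) := by
  have hd (n : ℕ) : MeasurableSet[f n] (disjointed s n) := by
    rw [disjointed_eq_inter_compl]
    exact (hs n).inter <| MeasurableSet.biInter (Set.to_countable _) fun i hi =>
      (f.mono (le_of_lt hi) _ (hs i)).compl
  have hdm (n : ℕ) : MeasurableSet (disjointed s n) := f.le n _ (hd n)
  rw [← iUnion_disjointed, measure_iUnion (disjoint_disjointed s) hdm,
    measure_iUnion (disjoint_disjointed s) hdm, ← ENNReal.tsum_mul_left]
  exact ENNReal.tsum_le_tsum fun n => h n _ (hd n) (disjointed_subset s n)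

theorem tsum_ite_coe_lt (t : ℕ∞) : ∑' n : ℕ, (if (n : ℕ∞) < t then (1 : ℝ≥0∞) else 0) = t := by
  cases t with
  | top => simp
  | coe N =>
    rw [tsum_eq_sum (s := Finset.range N) (by simp)]
    calc ∑ n ∈ Finset.range N, (if (n : ℕ∞) < N then (1 : ℝ≥0∞) else 0)
      _ = ∑ _n ∈ Finset.range N, 1 :=
        Finset.sum_congr rfl fun n hn => if_pos (mod_cast Finset.mem_range.1 hn)
      _ = N := by simp

theorem lintegral_enat_eq_tsum {Ω : Type*} {m : MeasurableSpace Ω} {μ : Measure Ω} {τ : Ω → ℕ∞}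
    (hτ : Measurable τ) : ∫⁻ ω, (τ ω : ℝ≥0∞) ∂μ = ∑' n : ℕ, μ {ω | (n : ℕ∞) < τ ω} := by
  have hm (n : ℕ) : MeasurableSet {ω | (n : ℕ∞) < τ ω} :=
    hτ (.of_discrete (s := Set.Ioi (n : ℕ∞)))
  simp only [← tsum_ite_coe_lt]
  rw [lintegral_tsum fun n =>
    (Measurable.ite (hm n) measurable_const measurable_const).aemeasurable]
  refine tsum_congr fun n => ?_
  rw [← lintegral_indicator_one (hm n)]
  simp only [Set.indicator_apply, Set.mem_ofPred_eq, Pi.one_apply]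

theorem lintegral_enat_le {Ω : Type*} {m : MeasurableSpace Ω} {μ : Measure Ω}
    [IsProbabilityMeasure μ] {τ : Ω → ℕ∞} (hτ : Measurable τ) {M : ℝ≥0∞} {s : ℕ → Set Ω}
    (h : ∀ n : ℕ, M ≤ (n + 1 : ℕ) → {ω | ((n + 1 : ℕ) : ℕ∞) < τ ω} ⊆ s n) :
    ∫⁻ ω, (τ ω : ℝ≥0∞) ∂μ ≤ M + 1 + ∑' n, μ (s n) := by
  rcases eq_or_ne M ⊤ with rfl | hM
  · simp
  set N := ⌊M.toNNReal⌋₊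
  have hlate (n : ℕ) : μ {ω | ((n + 1 : ℕ) : ℕ∞) < τ ω} ≤
      (if (n : ℕ∞) < (N : ℕ∞) then 1 else 0) + μ (s n) := by
    split_ifs with hn
    · exact prob_le_one.trans le_self_add
    · rw [zero_add]
      refine measure_mono (h n ?_)
      rw [← ENNReal.coe_toNNReal hM]
      exact_mod_cast ((Nat.floor_lt' n.succ_ne_zero).1
        (Nat.lt_succ_of_le (not_lt.1 (mod_cast hn)))).le
  have hNM : (N : ℝ≥0∞) ≤ M := by
    rw [← ENNReal.coe_toNNReal hM]
    exact_mod_cast Nat.floor_le (zero_le : 0 ≤ M.toNNReal)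
  rw [lintegral_enat_eq_tsum hτ, tsum_eq_zero_add' ENNReal.summable, add_comm M, add_assoc]
  refine add_le_add prob_le_one ((ENNReal.tsum_le_tsum hlate).trans ?_)
  rw [ENNReal.tsum_add, tsum_ite_coe_lt]
  exact add_le_add_left hNM _

theorem mul_measure_lt_le_lintegral_enat {Ω : Type*} {m : MeasurableSpace Ω} {μ : Measure Ω}
    {τ : Ω → ℕ∞} (hτ : Measurable τ) (N : ℕ) :
    ((N + 1 : ℕ) : ℝ≥0∞) * μ {ω | (N : ℕ∞) < τ ω} ≤ ∫⁻ ω, (τ ω : ℝ≥0∞) ∂μ := by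
  have hset : {ω | (N : ℕ∞) < τ ω} = {ω | ((N + 1 : ℕ) : ℝ≥0∞) ≤ (τ ω : ℝ≥0∞)} := by
    ext ω
    rw [Set.mem_ofPred_eq, Set.mem_ofPred_eq, ← ENat.toENNReal_coe, ENat.toENNReal_le]
    exact (ENat.add_one_le_iff (ENat.natCast_ne_top N)).symm
  rw [hset]
  exact mul_meas_ge_le_lintegral (Measurable.of_discrete.comp hτ) _

section Piecewise

variable {ι : Type*} [DecidableEq ι] {X : ι → Type*} {A B : Finset ι} {k : ι}

theorem piecewise_of_mem_symmDiff (hk : k ∈ A ∆ B) (f g : ∀ i, X i) :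
    B.piecewise f g k = A.piecewise g f k := by
  rcases Finset.mem_symmDiff.1 hk with ⟨hA, hB⟩ | ⟨hB, hA⟩ <;> simp [hA, hB]

theorem piecewise_of_notMem_symmDiff (hk : k ∉ A ∆ B) (f g : ∀ i, X i) :
    B.piecewise f g k = A.piecewise f g k := by
  have h : k ∈ A ↔ k ∈ B := by simpa [Finset.mem_symmDiff, not_or, iff_def] using hk
  simp only [Finset.piecewise, h]

end Piecewise

theorem LocallyEquivalent.trim_absolutelyContinuous {S : Type*} [MeasurableSpace S]
    {Q0 Q1 : Measure (ℕ → S)} [IsProbabilityMeasure Q0] [IsProbabilityMeasure Q1]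
    (h : LocallyEquivalent Q0 Q1) (n : ℕ) :
    Q1.trim (pathSigma_le S n) ≪ Q0.trim (pathSigma_le S n) ∧
      Q0.trim (pathSigma_le S n) ≪ Q1.trim (pathSigma_le S n) := by
  rcases n.eq_zero_or_pos with rfl | hn
  · have hbot : pathSigma S 0 = ⊥ := by simp [pathSigma]
    have htrim (s : Set (ℕ → S)) (hs : MeasurableSet[pathSigma S 0] s) :
        Q1.trim (pathSigma_le S 0) s = Q0.trim (pathSigma_le S 0) s := by
      rw [trim_measurableSet_eq _ hs, trim_measurableSet_eq _ hs]
      rw [hbot, MeasurableSpace.measurableSet_bot_iff] at hs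
      rcases hs with rfl | rfl <;> simp
    rw [@Measure.ext _ (pathSigma S 0) _ _ htrim]
    exact ⟨Measure.AbsolutelyContinuous.rfl, Measure.AbsolutelyContinuous.rfl⟩
  · exact h n hn

section LikelihoodRatio

variable {K : ℕ} {E : Fin K → Type*} [∀ k, MeasurableSpace (E k)]
  (P0 P1 : (k : Fin K) → Measure (ℕ → E k))

/-- The log-likelihood ratio of stream `k` in favour of its role when the signals are `A`:
`λ_k(n)` for a signal, `-λ_k(n)` for a noise. -/
noncomputable def streamLLR (A : Finset (Fin K)) (k : Fin K) (n : ℕ) (x : ℕ → E k) : ℝ :=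
  if k ∈ A then logLR (P0 k) (P1 k) n x else -logLR (P0 k) (P1 k) n x

/-- The log-likelihood ratio of `P_A` against `P_B` based on the first `n` observations of all the
streams; only the streams in which `A` and `B` differ contribute. -/
noncomputable def jointLLR (A B : Finset (Fin K)) (n : ℕ) (ω : Obs E) : ℝ :=
  ∑ k ∈ A ∆ B, streamLLR P0 P1 A k n (ω k)

theorem measurable_streamLLR (A : Finset (Fin K)) (k : Fin K) (n : ℕ) :
    Measurable[pathSigma (E k) n] (streamLLR P0 P1 A k n) := by
  have h : Measurable[pathSigma (E k) n] (logLR (P0 k) (P1 k) n) := measurable_llr _ _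
  unfold streamLLR
  split_ifs
  exacts [h, h.neg]

theorem measurable_streamLLR' (A : Finset (Fin K)) (k : Fin K) (n : ℕ) :
    Measurable (streamLLR P0 P1 A k n) :=
  (measurable_streamLLR P0 P1 A k n).mono (pathSigma_le _ n) le_rfl

theorem measurable_jointLLR (A B : Finset (Fin K)) (n : ℕ) :
    Measurable[obsFiltration E n] (jointLLR P0 P1 A B n) :=
  Finset.measurable_fun_sum _ fun k _ => (measurable_streamLLR P0 P1 A k n).comp
    (@measurable_pi_apply _ _ (fun k => pathSigma (E k) n) k)

theorem jointLLR_swap (A B : Finset (Fin K)) (n : ℕ) (ω : Obs E) :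
    jointLLR P0 P1 B A n ω = -jointLLR P0 P1 A B n ω := by
  rw [jointLLR, jointLLR, symmDiff_comm, ← Finset.sum_neg_distrib]
  refine Finset.sum_congr rfl fun k hk => ?_
  rcases Finset.mem_symmDiff.1 hk with ⟨hA, hB⟩ | ⟨hB, hA⟩ <;> simp [streamLLR, hA, hB]

variable [∀ k, IsProbabilityMeasure (P0 k)] [∀ k, IsProbabilityMeasure (P1 k)]

instance isProbabilityMeasure_piecewise (A : Finset (Fin K)) (k : Fin K) :
    IsProbabilityMeasure (A.piecewise P1 P0 k) :=
  A.piecewise_cases P1 P0 (fun μ => IsProbabilityMeasure μ) inferInstance inferInstance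

instance isProbabilityMeasure_jointLaw (A : Finset (Fin K)) :
    IsProbabilityMeasure (jointLaw P0 P1 A) :=
  inferInstanceAs (IsProbabilityMeasure (Measure.pi (A.piecewise P1 P0)))

variable {P0 P1}

theorem piecewise_eq_setLIntegral_exp_streamLLR
    (hequiv : ∀ k, LocallyEquivalent (P0 k) (P1 k)) (A : Finset (Fin K)) (k : Fin K) {n : ℕ}
    {s : Set (ℕ → E k)} (hs : MeasurableSet[pathSigma (E k) n] s) :
    A.piecewise P1 P0 k s =
      ∫⁻ x in s, ENNReal.ofReal (Real.exp (streamLLR P0 P1 A k n x)) ∂(A.piecewise P0 P1 k) := by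
  obtain ⟨h10, h01⟩ := (hequiv k).trim_absolutelyContinuous n
  by_cases hk : k ∈ A
  · simpa [hk, streamLLR, logLR] using measure_eq_setLIntegral_exp_llr_trim _ h10 h01 hs
  · simpa [hk, streamLLR, logLR] using measure_eq_setLIntegral_exp_neg_llr_trim _ h10 h01 hs

theorem jointLaw_eq_setLIntegral_exp_jointLLR
    (hequiv : ∀ k, LocallyEquivalent (P0 k) (P1 k)) (A B : Finset (Fin K)) {n : ℕ}
    {s : Set (Obs E)} (hs : MeasurableSet[obsFiltration E n] s) :
    jointLaw P0 P1 A s =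
      ∫⁻ ω in s, ENNReal.ofReal (Real.exp (jointLLR P0 P1 A B n ω)) ∂(jointLaw P0 P1 B) := by
  set f : ∀ k, (ℕ → E k) → ℝ≥0∞ := fun k x =>
    if k ∈ A ∆ B then ENNReal.ofReal (Real.exp (streamLLR P0 P1 A k n x)) else 1 with hf_def
  have hf (k : Fin K) : Measurable (f k) :=
    .ite (.const _) (measurable_streamLLR' P0 P1 A k n).exp.ennreal_ofReal measurable_const
  have hdensity (k : Fin K) (t : Set (ℕ → E k)) (ht : MeasurableSet[pathSigma (E k) n] t) :
      A.piecewise P1 P0 k t = ∫⁻ x in t, f k x ∂(B.piecewise P1 P0 k) := by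
    by_cases hk : k ∈ A ∆ B
    · simp only [hf_def, if_pos hk, piecewise_of_mem_symmDiff hk]
      exact piecewise_eq_setLIntegral_exp_streamLLR hequiv A k ht
    · simp only [hf_def, if_neg hk, piecewise_of_notMem_symmDiff hk, setLIntegral_one]
  have hprod (ω : Obs E) :
      ∏ k, f k (ω k) = ENNReal.ofReal (Real.exp (jointLLR P0 P1 A B n ω)) := by
    rw [jointLLR, Real.exp_sum, ENNReal.ofReal_prod_of_nonneg fun _ _ => (Real.exp_pos _).le,
      Finset.prod_ite_mem, Finset.univ_inter]
  simp only [← hprod]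
  exact pi_apply_eq_setLIntegral_prod (fun k => pathSigma_le (E k) n) (A.piecewise P1 P0)
    (B.piecewise P1 P0) hf hdensity hs

theorem jointLaw_le_exp_mul (hequiv : ∀ k, LocallyEquivalent (P0 k) (P1 k))
    (A B : Finset (Fin K)) {n : ℕ} {s : Set (Obs E)}
    (hs : MeasurableSet[obsFiltration E n] s) {c : ℝ}
    (hc : ∀ ω ∈ s, jointLLR P0 P1 A B n ω ≤ c) :
    jointLaw P0 P1 A s ≤ ENNReal.ofReal (Real.exp c) * jointLaw P0 P1 B s := by
  rw [jointLaw_eq_setLIntegral_exp_jointLLR hequiv A B hs, ← setLIntegral_const]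
  exact setLIntegral_mono' ((obsFiltration E).le n _ hs) fun ω hω =>
    ENNReal.ofReal_le_ofReal (Real.exp_le_exp.2 (hc ω hω))

theorem jointLaw_exists_le_jointLLR (hequiv : ∀ k, LocallyEquivalent (P0 k) (P1 k))
    (A B : Finset (Fin K)) (a : ℝ) :
    jointLaw P0 P1 B {ω | ∃ n, a ≤ jointLLR P0 P1 A B n ω} ≤ ENNReal.ofReal (Real.exp (-a)) := by
  rw [Set.ofPred_exists]
  refine (measure_iUnion_le_mul (obsFiltration E)
    (fun n => measurable_jointLLR P0 P1 A B n measurableSet_Ici) fun n t ht hsub =>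
      jointLaw_le_exp_mul hequiv B A ht fun ω hω => ?_).trans (mul_le_of_le_one_right' prob_le_one)
  rw [jointLLR_swap, neg_le_neg_iff]
  exact hsub hω

end LikelihoodRatio

section Rates

variable {K : ℕ} {E : Fin K → Type*} [∀ k, MeasurableSpace (E k)]

/-- The rate at which the log-likelihood ratio of `P_A` against `P_B` grows under `P_A`. -/
def infoRate (I J : Fin K → ℝ) (A B : Finset (Fin K)) : ℝ := ∑ k ∈ A ∆ B, A.piecewise I J k

/-- The event that, after `n` observations, some stream has gathered less than a fraction `θ` of
the evidence for its role under `P_A` that its rate predicts. -/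
def lagSet (P0 P1 : (k : Fin K) → Measure (ℕ → E k)) (I J : Fin K → ℝ) (A : Finset (Fin K))
    (θ : ℝ) (n : ℕ) : Set (Obs E) :=
  {ω | ∃ k, streamLLR P0 P1 A k n (ω k) / n ≤ θ * A.piecewise I J k}

variable {P0 P1 : (k : Fin K) → Measure (ℕ → E k)} {I J : Fin K → ℝ}

theorem piecewise_pos (hI : ∀ k, 0 < I k) (hJ : ∀ k, 0 < J k) (A : Finset (Fin K)) (k : Fin K) :
    0 < A.piecewise I J k :=
  A.piecewise_cases I J (0 < ·) (hI k) (hJ k)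

theorem infoRate_pos (hI : ∀ k, 0 < I k) (hJ : ∀ k, 0 < J k) {A B : Finset (Fin K)} {k : Fin K}
    (hk : k ∈ A ∆ B) : 0 < infoRate I J A B :=
  Finset.sum_pos (fun k _ => piecewise_pos hI hJ A k) ⟨k, hk⟩

theorem limsupRateLE_streamLLR (hlim1 : ∀ k, LimsupRateLE (P1 k) (logLR (P0 k) (P1 k)) (I k))
    (hlim0 : ∀ k, LimsupRateLE (P0 k) (fun n x => -logLR (P0 k) (P1 k) n x) (J k))
    (A : Finset (Fin K)) (k : Fin K) :
    LimsupRateLE (A.piecewise P1 P0 k) (streamLLR P0 P1 A k) (A.piecewise I J k) := by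
  unfold streamLLR
  by_cases hk : k ∈ A
  · simpa [hk] using hlim1 k
  · simpa [hk] using hlim0 k

theorem completeRateGE_streamLLR (hcomp1 : ∀ k, CompleteRateGE (P1 k) (logLR (P0 k) (P1 k)) (I k))
    (hcomp0 : ∀ k, CompleteRateGE (P0 k) (fun n x => -logLR (P0 k) (P1 k) n x) (J k))
    (A : Finset (Fin K)) (k : Fin K) :
    CompleteRateGE (A.piecewise P1 P0 k) (streamLLR P0 P1 A k) (A.piecewise I J k) := by
  unfold streamLLR
  by_cases hk : k ∈ A
  · simpa [hk] using hcomp1 k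
  · simpa [hk] using hcomp0 k

theorem LimsupRateLE.ae_eventually_le {Ω : Type*} [MeasurableSpace Ω] {Q : Measure Ω}
    {ξ : ℕ → Ω → ℝ} {c d : ℝ} (h : LimsupRateLE Q ξ c) (hcd : c < d) :
    ∀ᵐ x ∂Q, ∀ᶠ n : ℕ in atTop, ξ n x ≤ d * n := by
  filter_upwards [h] with x hx
  filter_upwards [eventually_lt_of_limsup_lt (hx.trans_lt (EReal.coe_lt_coe_iff.2 hcd)),
    eventually_gt_atTop 0] with n hn hn0
  exact ((div_lt_iff₀ (Nat.cast_pos.2 hn0)).1 (EReal.coe_lt_coe_iff.1 hn)).le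

theorem mul_infoRate_mul_le_jointLLR {A : Finset (Fin K)} {θ : ℝ} {n : ℕ} (hn : 0 < n)
    {ω : Obs E} (hω : ω ∉ lagSet P0 P1 I J A θ n) (B : Finset (Fin K)) :
    θ * infoRate I J A B * n ≤ jointLLR P0 P1 A B n ω := by
  simp only [lagSet, Set.mem_ofPred_eq, not_exists, not_le] at hω
  rw [infoRate, jointLLR, Finset.mul_sum, Finset.sum_mul]
  exact Finset.sum_le_sum fun k _ => ((lt_div_iff₀ (Nat.cast_pos.2 hn)).1 (hω k)).le

variable [∀ k, IsProbabilityMeasure (P0 k)] [∀ k, IsProbabilityMeasure (P1 k)]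

theorem measurePreserving_eval_jointLaw (A : Finset (Fin K)) (k : Fin K) :
    MeasurePreserving (fun ω : Obs E => ω k) (jointLaw P0 P1 A) (A.piecewise P1 P0 k) :=
  measurePreserving_eval (A.piecewise P1 P0) k

theorem ae_eventually_jointLLR_le (hI : ∀ k, 0 < I k) (hJ : ∀ k, 0 < J k) {A : Finset (Fin K)}
    (hlim : ∀ k, LimsupRateLE (A.piecewise P1 P0 k) (streamLLR P0 P1 A k) (A.piecewise I J k))
    (B : Finset (Fin K)) {θ : ℝ} (hθ : 1 < θ) :
    ∀ᵐ ω ∂(jointLaw P0 P1 A), ∀ᶠ n : ℕ in atTop,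
      jointLLR P0 P1 A B n ω ≤ θ * infoRate I J A B * n := by
  have hstream (k : Fin K) : ∀ᵐ ω ∂(jointLaw P0 P1 A), ∀ᶠ n : ℕ in atTop,
      streamLLR P0 P1 A k n (ω k) ≤ θ * A.piecewise I J k * n :=
    (measurePreserving_eval_jointLaw A k).quasiMeasurePreserving.ae <|
      (hlim k).ae_eventually_le (lt_mul_of_one_lt_left (piecewise_pos hI hJ A k) hθ)
  filter_upwards [ae_all_iff.2 hstream] with ω hω
  filter_upwards [eventually_all.2 hω] with n hn
  rw [infoRate, jointLLR, Finset.mul_sum, Finset.sum_mul]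
  exact Finset.sum_le_sum fun k _ => hn k

theorem tsum_jointLaw_lagSet_ne_top (hI : ∀ k, 0 < I k) (hJ : ∀ k, 0 < J k) {A : Finset (Fin K)}
    (hcomp : ∀ k, CompleteRateGE (A.piecewise P1 P0 k) (streamLLR P0 P1 A k)
      (A.piecewise I J k)) {θ : ℝ} (hθ : θ < 1) :
    ∑' n, jointLaw P0 P1 A (lagSet P0 P1 I J A θ (n + 1)) ≠ ∞ := by
  set lag : Fin K → ℕ → Set (Obs E) := fun k n =>
    {ω | streamLLR P0 P1 A k (n + 1) (ω k) / (n + 1 : ℕ) ≤ θ * A.piecewise I J k}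
  have hstream (k : Fin K) : ∑' n, jointLaw P0 P1 A (lag k n) < ∞ := by
    have hε : 0 < (1 - θ) * A.piecewise I J k :=
      mul_pos (sub_pos.2 hθ) (piecewise_pos hI hJ A k)
    convert hcomp k _ hε using 3 with n
    rw [show A.piecewise I J k - (1 - θ) * A.piecewise I J k = θ * A.piecewise I J k by ring]
    exact (measurePreserving_eval_jointLaw A k).measure_preimage
      (measurableSet_le ((measurable_streamLLR' P0 P1 A k (n + 1)).div_const _)
        measurable_const).nullMeasurableSet
  refine ne_of_lt ?_
  calc ∑' n, jointLaw P0 P1 A (lagSet P0 P1 I J A θ (n + 1))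
      ≤ ∑' n, ∑ k, jointLaw P0 P1 A (lag k n) := ENNReal.tsum_le_tsum fun n => by
        rw [lagSet, Set.ofPred_exists]
        exact measure_iUnion_fintype_le _ _
    _ = ∑ k, ∑' n, jointLaw P0 P1 A (lag k n) :=
        Summable.tsum_finsetSum fun _ _ => ENNReal.summable
    _ < ∞ := ENNReal.sum_lt_top.2 fun k _ => hstream k

end Rates

theorem measurable_of_isStoppingTime {Ω : Type*} {m : MeasurableSpace Ω} {f : Filtration ℕ m}
    {τ : Ω → ℕ∞} (hτ : IsStoppingTime f τ) : Measurable τ :=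
  ENat.measurable_iff.2 fun n => f.le n _ (hτ.measurableSet_eq n)

section LowerBound

variable {K : ℕ} {E : Fin K → Type*} [∀ k, MeasurableSpace (E k)]
  {P0 P1 : (k : Fin K) → Measure (ℕ → E k)} {C : Set (Finset (Fin K))} {A B : Finset (Fin K)}

theorem Procedure.measurable_T (χ : Procedure E) (k : Fin K) : Measurable (χ.T k) :=
  measurable_of_isStoppingTime (χ.isStoppingTime_T k)

theorem jointLaw_wrong_le {α β : ℝ} {χ : Procedure E} (hχ : χ ∈ controlled P0 P1 α β C)
    (hA : A ∈ C) (k : Fin K) :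
    jointLaw P0 P1 A {ω | χ.D k ω ≠ decide (k ∈ A)} ≤
      ENNReal.ofReal (if k ∈ A then β else α) := by
  obtain ⟨-, hfalse_pos, hfalse_neg⟩ := hχ A hA
  by_cases hk : k ∈ A
  · rw [if_pos hk]
    refine (measure_mono fun ω (hω : _ ≠ _) => ?_).trans hfalse_neg
    exact ⟨k, hk, by simpa [hk] using hω⟩
  · rw [if_neg hk]
    refine (measure_mono fun ω (hω : _ ≠ _) => ?_).trans hfalse_pos
    exact ⟨k, hk, by simpa [hk] using hω⟩

theorem jointLaw_decision_le_of_mem_symmDiff {α β : ℝ} {χ : Procedure E}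
    (hχ : χ ∈ controlled P0 P1 α β C) (hB : B ∈ C) {k : Fin K} (hk : k ∈ A ∆ B) :
    jointLaw P0 P1 B {ω | χ.D k ω = decide (k ∈ A)} ≤
      ENNReal.ofReal (if k ∈ A then α else β) := by
  have h := jointLaw_wrong_le hχ hB k
  rcases Finset.mem_symmDiff.1 hk with ⟨hkA, hkB⟩ | ⟨hkB, hkA⟩ <;> simpa [hkA, hkB] using h

theorem optTime_le_optTimeSync [NeZero K] (P0 P1 : (k : Fin K) → Measure (ℕ → E k)) (k : Fin K)
    (A : Finset (Fin K)) (α β : ℝ) (C : Set (Finset (Fin K))) :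
    optTime P0 P1 k A α β C ≤ optTimeSync P0 P1 A α β C :=
  le_iInf₂ fun χ hχ => (iInf₂_le χ hχ.1).trans_eq (by rw [expTime, expTime, hχ.2 k 0])

variable [∀ k, IsProbabilityMeasure (P0 k)] [∀ k, IsProbabilityMeasure (P1 k)]

theorem jointLaw_T_le (hequiv : ∀ k, LocallyEquivalent (P0 k) (P1 k)) (χ : Procedure E)
    (A B : Finset (Fin K)) (k : Fin K) (b : Bool) (N : ℕ) (c : ℝ) :
    jointLaw P0 P1 A {ω | χ.T k ω ≤ N} ≤
      jointLaw P0 P1 A {ω | χ.D k ω ≠ b} +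
      jointLaw P0 P1 A {ω | ∃ n ≤ N, c < jointLLR P0 P1 A B n ω} +
      ENNReal.ofReal (Real.exp c) * jointLaw P0 P1 B {ω | χ.D k ω = b} := by
  set s : ℕ → Set (Obs E) := fun n =>
    {ω | χ.T k ω = n ∧ χ.D k ω = b} ∩ {ω | jointLLR P0 P1 A B n ω ≤ c}
  have hs (n : ℕ) : MeasurableSet[obsFiltration E n] (s n) :=
    (χ.measurableSet_D k n b).inter (measurable_jointLLR P0 P1 A B n measurableSet_Iic)
  have hcover : {ω | χ.T k ω ≤ N} ⊆
      {ω | χ.D k ω ≠ b} ∪ {ω | ∃ n ≤ N, c < jointLLR P0 P1 A B n ω} ∪ ⋃ n, s n := by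
    intro ω (hω : χ.T k ω ≤ N)
    obtain ⟨n, hn⟩ := ENat.ne_top_iff_exists.1 (ne_top_of_le_ne_top (ENat.natCast_ne_top N) hω)
    have hnN : n ≤ N := by rw [← hn] at hω; exact_mod_cast hω
    by_cases hb : χ.D k ω = b
    · rcases le_or_gt (jointLLR P0 P1 A B n ω) c with hc | hc
      · exact Or.inr (Set.mem_iUnion.2 ⟨n, ⟨hn.symm, hb⟩, hc⟩)
      · exact Or.inl (Or.inr ⟨n, hnN, hc⟩)
    · exact Or.inl (Or.inl hb)
  have hchange : jointLaw P0 P1 A (⋃ n, s n) ≤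
      ENNReal.ofReal (Real.exp c) * jointLaw P0 P1 B (⋃ n, s n) :=
    measure_iUnion_le_mul (obsFiltration E) hs fun n t ht hsub =>
      jointLaw_le_exp_mul hequiv A B ht fun ω hω => (hsub hω).2
  refine (measure_mono hcover).trans ((measure_union_le _ _).trans ?_)
  refine add_le_add (measure_union_le _ _) (hchange.trans ?_)
  gcongr
  exact Set.iUnion_subset fun n ω hω => hω.1.2

theorem mul_le_optTime (hequiv : ∀ k, LocallyEquivalent (P0 k) (P1 k)) (hA : A ∈ C) (hB : B ∈ C)
    {k : Fin K} (hk : k ∈ A ∆ B) (α β : ℝ) (N : ℕ) (c : ℝ) :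
    ((N + 1 : ℕ) : ℝ≥0∞) * (1 - (ENNReal.ofReal (if k ∈ A then β else α) +
        jointLaw P0 P1 A {ω | ∃ n ≤ N, c < jointLLR P0 P1 A B n ω} +
        ENNReal.ofReal (Real.exp c) * ENNReal.ofReal (if k ∈ A then α else β))) ≤
      optTime P0 P1 k A α β C := by
  refine le_iInf₂ fun χ hχ =>
    le_trans ?_ (mul_measure_lt_le_lintegral_enat (χ.measurable_T k) N)
  have hcompl : {ω | (N : ℕ∞) < χ.T k ω} = {ω | χ.T k ω ≤ N}ᶜ := by ext ω; simp
  have hmeas : MeasurableSet {ω | χ.T k ω ≤ N} := χ.measurable_T k .of_discrete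
  rw [hcompl, prob_compl_eq_one_sub hmeas]
  gcongr
  refine (jointLaw_T_le hequiv χ A B k (decide (k ∈ A)) N c).trans ?_
  gcongr
  exacts [jointLaw_wrong_le hχ hA k, jointLaw_decision_le_of_mem_symmDiff hχ hB hk]

end LowerBound

section HittingProcedure

variable {K : ℕ} {E : Fin K → Type*} [∀ k, MeasurableSpace (E k)]

theorem isStoppingTime_hittingAfter_mem {Ω : Type*} {m : MeasurableSpace Ω} {f : Filtration ℕ m}
    {s : ℕ → Set Ω} (hs : ∀ n, MeasurableSet[f n] (s n)) (n₀ : ℕ) :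
    IsStoppingTime f (hittingAfter (fun n ω => ω ∈ s n) {True} n₀) :=
  Adapted.isStoppingTime_hittingAfter
    (fun n => (@measurableSet_setOfPred _ (f n) _).1 (hs n)) .of_discrete

open scoped Classical in
/-- The procedure which decides stream `k` at the first time `n ≥ 1` at which the observations lie
in `S k n`, and then identifies it as a signal iff they lie in `G k n`.
On the event that they never lie in `S k n`, the decision is a junk value. -/
noncomputable def hittingProcedure (S G : Fin K → ℕ → Set (Obs E))
    (hS : ∀ k n, MeasurableSet[obsFiltration E n] (S k n))
    (hG : ∀ k n, MeasurableSet[obsFiltration E n] (G k n)) : Procedure E where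
  T k := hittingAfter (fun n ω => ω ∈ S k n) {True} 1
  D k ω := decide (ω ∈ G k (ENat.toNat (hittingAfter (fun n ω => ω ∈ S k n) {True} 1 ω)))
  one_le_T k ω := le_hittingAfter ω
  isStoppingTime_T k := isStoppingTime_hittingAfter_mem (hS k) 1
  measurable_D k := by
    set τ : Obs E → ℕ∞ := hittingAfter (fun n ω => ω ∈ S k n) {True} 1
    have hτ : Measurable τ :=
      measurable_of_isStoppingTime (isStoppingTime_hittingAfter_mem (hS k) 1)
    have hunion : (fun ω => decide (ω ∈ G k (τ ω).toNat)) ⁻¹' {true} =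
        ⋃ n, τ ⁻¹' {t | t.toNat = n} ∩ G k n := by
      ext ω; simp
    refine measurable_to_bool (hunion ▸ MeasurableSet.iUnion fun n => ?_)
    exact (hτ .of_discrete).inter ((obsFiltration E).le n _ (hG k n))
  measurableSet_D k n b := by
    set τ : Obs E → ℕ∞ := hittingAfter (fun n ω => ω ∈ S k n) {True} 1
    have hτ : MeasurableSet[obsFiltration E n] {ω | τ ω = n} :=
      (isStoppingTime_hittingAfter_mem (hS k) 1).measurableSet_eq n
    have hinter : {ω | τ ω = n ∧ decide (ω ∈ G k (τ ω).toNat) = b} =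
        {ω | τ ω = n} ∩ (if b then G k n else (G k n)ᶜ) := by
      ext ω
      refine and_congr_right fun (h : τ ω = n) => ?_
      cases b <;> simp [h]
    rw [hinter]
    cases b
    exacts [hτ.inter (hG k n).compl, hτ.inter (hG k n)]

variable {S G : Fin K → ℕ → Set (Obs E)}
  {hS : ∀ k n, MeasurableSet[obsFiltration E n] (S k n)}
  {hG : ∀ k n, MeasurableSet[obsFiltration E n] (G k n)} {k : Fin K} {ω : Obs E}

theorem hittingProcedure_T_le {n : ℕ} (hn : 1 ≤ n) (h : ω ∈ S k n) :
    (hittingProcedure S G hS hG).T k ω ≤ n :=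
  hittingAfter_le_of_mem hn (eq_true h)

theorem exists_mem_of_hittingProcedure_D_eq_true (h : (hittingProcedure S G hS hG).D k ω = true) :
    ∃ n, ω ∈ G k n :=
  ⟨_, by simpa [hittingProcedure] using h⟩

theorem exists_mem_notMem_of_hittingProcedure_D_eq_false
    (hT : (hittingProcedure S G hS hG).T k ω ≠ ⊤)
    (h : (hittingProcedure S G hS hG).D k ω = false) : ∃ n, ω ∈ S k n ∧ ω ∉ G k n := by
  obtain ⟨n, hn⟩ := WithTop.ne_top_iff_exists.1 hT
  have hmem := of_eq_true (hittingAfter_mem_set_of_ne_top hT)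
  simp only [hittingProcedure, decide_eq_false_iff_not] at hn h
  rw [← hn] at hmem h
  exact ⟨n, hmem, h⟩

end HittingProcedure

section Leaders

variable {K : ℕ} {E : Fin K → Type*} [∀ k, MeasurableSpace (E k)]

/-- The separation rate of stream `k` under `P_A`: the smallest rate at which `P_A` can be told from
a member of the class `C` in which stream `k` has the opposite role. It is `∞` if there is none. -/
noncomputable def sepRate (I J : Fin K → ℝ) (C : Set (Finset (Fin K))) (A : Finset (Fin K))
    (k : Fin K) : ℝ≥0∞ :=
  ⨅ B ∈ C, ⨅ (_ : k ∈ A ∆ B), ENNReal.ofReal (infoRate I J A B)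

/-- The event that, after `n` observations, `A` leads in the streams of `W`: its likelihood ratio
against every member of `C` that disagrees with it in some `k ∈ W` has reached the level `a` if `A`
declares `k` to be a signal and the level `b` if `A` declares it to be a noise. -/
def leadSet (P0 P1 : (k : Fin K) → Measure (ℕ → E k)) (C : Set (Finset (Fin K))) (a b : ℝ)
    (A W : Finset (Fin K)) (n : ℕ) : Set (Obs E) :=
  {ω | ∀ k ∈ W, ∀ B ∈ C, k ∈ A ∆ B → (if k ∈ A then a else b) ≤ jointLLR P0 P1 A B n ω}

theorem measurableSet_leadSet (P0 P1 : (k : Fin K) → Measure (ℕ → E k))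
    (C : Set (Finset (Fin K))) (a b : ℝ) (A W : Finset (Fin K)) (n : ℕ) :
    MeasurableSet[obsFiltration E n] (leadSet P0 P1 C a b A W n) := by
  simp only [leadSet, Set.ofPred_forall]
  exact .iInter fun _ => .iInter fun _ => .iInter fun B => .iInter fun _ => .iInter fun _ =>
    measurable_jointLLR P0 P1 A B n measurableSet_Ici

/-- The procedure of leaders: stream `k` is decided as soon as some member of `C` leads in the
streams of `W k`, and is then identified as a signal iff it is one for such a leader.
It is asynchronous for `W k = {k}` and synchronous for `W k = [K]`. -/
noncomputable def leadProcedure (P0 P1 : (k : Fin K) → Measure (ℕ → E k))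
    (C : Set (Finset (Fin K))) (a b : ℝ) (W : Fin K → Finset (Fin K)) : Procedure E :=
  hittingProcedure (fun k n => ⋃ A ∈ C, leadSet P0 P1 C a b A (W k) n)
    (fun k n => ⋃ A ∈ {A ∈ C | k ∈ A}, leadSet P0 P1 C a b A (W k) n)
    (fun _ _ => .biUnion (Set.to_countable _) fun _ _ => measurableSet_leadSet ..)
    (fun _ _ => .biUnion (Set.to_countable _) fun _ _ => measurableSet_leadSet ..)

variable {P0 P1 : (k : Fin K) → Measure (ℕ → E k)} {I J : Fin K → ℝ}
  {C : Set (Finset (Fin K))} {a b : ℝ} {A B : Finset (Fin K)} {W : Fin K → Finset (Fin K)}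
  {k : Fin K} {θ : ℝ}

theorem piecewise_le_sepRate (hI : ∀ k, 0 < I k) (hJ : ∀ k, 0 < J k) (C : Set (Finset (Fin K)))
    (A : Finset (Fin K)) (k : Fin K) :
    ENNReal.ofReal (A.piecewise I J k) ≤ sepRate I J C A k :=
  le_iInf₂ fun _ _ => le_iInf fun hk => ENNReal.ofReal_le_ofReal <|
    Finset.single_le_sum (fun k _ => (piecewise_pos hI hJ A k).le) hk

theorem sepRate_ne_zero (hI : ∀ k, 0 < I k) (hJ : ∀ k, 0 < J k) (C : Set (Finset (Fin K)))
    (A : Finset (Fin K)) (k : Fin K) : sepRate I J C A k ≠ 0 :=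
  ((ENNReal.ofReal_pos.2 (piecewise_pos hI hJ A k)).trans_le
    (piecewise_le_sepRate hI hJ C A k)).ne'

theorem sepRate_le_infoRate (hB : B ∈ C) (hk : k ∈ A ∆ B) :
    sepRate I J C A k ≤ ENNReal.ofReal (infoRate I J A B) :=
  iInf₂_le_of_le B hB (iInf_le _ hk)

theorem mem_leadSet_of_notMem_lagSet (hI : ∀ k, 0 < I k) (hJ : ∀ k, 0 < J k) (hθ : 0 < θ)
    {W : Finset (Fin K)} {n : ℕ} (hn : 0 < n)
    (hlevel : (⨆ k ∈ W, ENNReal.ofReal (if k ∈ A then a else b) / sepRate I J C A k) /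
      ENNReal.ofReal θ ≤ n)
    {ω : Obs E} (hω : ω ∉ lagSet P0 P1 I J A θ n) : ω ∈ leadSet P0 P1 C a b A W n := by
  intro k hkW B hB hk
  refine le_trans ?_ (mul_infoRate_mul_le_jointLLR hn hω B)
  have hR : 0 < infoRate I J A B := infoRate_pos hI hJ hk
  refine (ENNReal.ofReal_le_ofReal_iff (by positivity)).1 ?_
  have hθ0 : ENNReal.ofReal θ ≠ 0 := (ENNReal.ofReal_pos.2 hθ).ne'
  have hn0 : (n : ℝ≥0∞) * ENNReal.ofReal θ ≠ 0 := mul_ne_zero (Nat.cast_ne_zero.2 hn.ne') hθ0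
  have hntop : (n : ℝ≥0∞) * ENNReal.ofReal θ ≠ ∞ :=
    ENNReal.mul_ne_top (ENNReal.natCast_ne_top n) ENNReal.ofReal_ne_top
  rw [ENNReal.div_le_iff hθ0 ENNReal.ofReal_ne_top] at hlevel
  calc ENNReal.ofReal (if k ∈ A then a else b)
      ≤ n * ENNReal.ofReal θ * sepRate I J C A k :=
        (ENNReal.div_le_iff_le_mul (.inr hntop) (.inr hn0)).1 ((le_iSup₂ _ hkW).trans hlevel)
    _ ≤ n * ENNReal.ofReal θ * ENNReal.ofReal (infoRate I J A B) := by
        gcongr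
        exact sepRate_le_infoRate hB hk
    _ = ENNReal.ofReal (θ * infoRate I J A B * n) := by
        rw [ENNReal.ofReal_mul' n.cast_nonneg, ENNReal.ofReal_mul hθ.le, ENNReal.ofReal_natCast]
        ring

theorem leadProcedure_T_le (hA : A ∈ C) {n : ℕ} (hn : 1 ≤ n) {ω : Obs E}
    (hω : ω ∈ leadSet P0 P1 C a b A (W k) n) : (leadProcedure P0 P1 C a b W).T k ω ≤ n :=
  hittingProcedure_T_le hn (Set.mem_biUnion hA hω)

theorem exists_le_jointLLR_of_leadProcedure_D_eq_true (hW : k ∈ W k) (hB : B ∈ C) (hk : k ∉ B)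
    {ω : Obs E} (hω : (leadProcedure P0 P1 C a b W).D k ω = true) :
    ∃ A n, a ≤ jointLLR P0 P1 A B n ω := by
  obtain ⟨n, hn⟩ := exists_mem_of_hittingProcedure_D_eq_true hω
  obtain ⟨A, ⟨-, hkA⟩, hlead⟩ := Set.mem_iUnion₂.1 hn
  exact ⟨A, n, by simpa [hkA] using hlead k hW B hB (Finset.mem_symmDiff.2 (.inl ⟨hkA, hk⟩))⟩

theorem exists_le_jointLLR_of_leadProcedure_D_eq_false (hW : k ∈ W k) (hB : B ∈ C) (hk : k ∈ B)
    {ω : Obs E} (hT : (leadProcedure P0 P1 C a b W).T k ω ≠ ⊤)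
    (hω : (leadProcedure P0 P1 C a b W).D k ω = false) :
    ∃ A n, b ≤ jointLLR P0 P1 A B n ω := by
  obtain ⟨n, hS, hG⟩ := exists_mem_notMem_of_hittingProcedure_D_eq_false hT hω
  obtain ⟨A, hA, hlead⟩ := Set.mem_iUnion₂.1 hS
  have hkA : k ∉ A := fun hkA => hG (Set.mem_biUnion ⟨hA, hkA⟩ hlead)
  exact ⟨A, n, by simpa [hkA] using hlead k hW B hB (Finset.mem_symmDiff.2 (.inr ⟨hk, hkA⟩))⟩

variable [∀ k, IsProbabilityMeasure (P0 k)] [∀ k, IsProbabilityMeasure (P1 k)]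

theorem expTime_leadProcedure_le (hI : ∀ k, 0 < I k) (hJ : ∀ k, 0 < J k) (hA : A ∈ C) (a b : ℝ)
    (W : Fin K → Finset (Fin K)) (k : Fin K) (hθ : 0 < θ) :
    expTime P0 P1 A (leadProcedure P0 P1 C a b W) k ≤
      (⨆ k' ∈ W k, ENNReal.ofReal (if k' ∈ A then a else b) / sepRate I J C A k') /
        ENNReal.ofReal θ + 1 +
      ∑' n, jointLaw P0 P1 A (lagSet P0 P1 I J A θ (n + 1)) := by
  refine lintegral_enat_le (Procedure.measurable_T _ k) fun n hn ω hω => ?_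
  by_contra hlag
  exact hω.not_ge <| leadProcedure_T_le hA n.succ_pos <|
    mem_leadSet_of_notMem_lagSet hI hJ hθ n.succ_pos hn hlag

theorem ae_leadProcedure_T_ne_top (hI : ∀ k, 0 < I k) (hJ : ∀ k, 0 < J k)
    (hcomp : ∀ k, CompleteRateGE (A.piecewise P1 P0 k) (streamLLR P0 P1 A k)
      (A.piecewise I J k)) (hA : A ∈ C) (a b : ℝ) (W : Fin K → Finset (Fin K)) (k : Fin K) :
    ∀ᵐ ω ∂(jointLaw P0 P1 A), (leadProcedure P0 P1 C a b W).T k ω ≠ ⊤ := by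
  have hlevel : (⨆ k' ∈ W k, ENNReal.ofReal (if k' ∈ A then a else b) / sepRate I J C A k') /
      ENNReal.ofReal (1 / 2) ≠ ∞ := by
    simp only [← Finset.sup_eq_iSup]
    refine ENNReal.div_ne_top ((Finset.sup_lt_iff ENNReal.zero_lt_top).2 fun k' _ => ?_).ne
      (by simp)
    exact ENNReal.div_lt_top ENNReal.ofReal_ne_top (sepRate_ne_zero hI hJ C A k')
  have hfinite : expTime P0 P1 A (leadProcedure P0 P1 C a b W) k ≠ ∞ :=
    ne_top_of_le_ne_top
      (ENNReal.add_ne_top.2 ⟨ENNReal.add_ne_top.2 ⟨hlevel, ENNReal.one_ne_top⟩,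
        tsum_jointLaw_lagSet_ne_top hI hJ hcomp one_half_lt_one⟩)
      (expTime_leadProcedure_le hI hJ hA a b W k one_half_pos)
  have hmeas : Measurable fun ω => ((leadProcedure P0 P1 C a b W).T k ω : ℝ≥0∞) :=
    (measurable_from_top (f := ENat.toENNReal)).comp (Procedure.measurable_T _ k)
  filter_upwards [ae_lt_top hmeas hfinite] with ω hω
  exact fun h => hω.ne (by rw [h, ENat.toENNReal_top])

theorem jointLaw_exists_exists_le_jointLLR (hequiv : ∀ k, LocallyEquivalent (P0 k) (P1 k))
    (B : Finset (Fin K)) {γ : ℝ} (hγ : 0 < γ) :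
    jointLaw P0 P1 B {ω | ∃ A n, Real.log (2 ^ K / γ) ≤ jointLLR P0 P1 A B n ω} ≤
      ENNReal.ofReal γ := by
  have hlevel : Real.exp (-Real.log (2 ^ K / γ)) = γ / 2 ^ K := by
    rw [← Real.log_inv, Real.exp_log (by positivity), inv_div]
  calc jointLaw P0 P1 B {ω | ∃ A n, Real.log (2 ^ K / γ) ≤ jointLLR P0 P1 A B n ω}
      ≤ ∑ A, jointLaw P0 P1 B {ω | ∃ n, Real.log (2 ^ K / γ) ≤ jointLLR P0 P1 A B n ω} := by
        rw [Set.ofPred_exists]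
        exact measure_iUnion_fintype_le _ _
    _ ≤ ∑ _A : Finset (Fin K), ENNReal.ofReal (γ / 2 ^ K) :=
        Finset.sum_le_sum fun A _ => hlevel ▸ jointLaw_exists_le_jointLLR hequiv A B _
    _ = ENNReal.ofReal γ := by
        rw [Finset.sum_const, ← ENNReal.ofReal_nsmul]
        congr 1
        simp only [Finset.card_univ, Fintype.card_finset, Fintype.card_fin, nsmul_eq_mul]
        push_cast
        field_simp

theorem leadProcedure_mem_controlled (hI : ∀ k, 0 < I k) (hJ : ∀ k, 0 < J k)
    (hequiv : ∀ k, LocallyEquivalent (P0 k) (P1 k))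
    (hcomp : ∀ A k, CompleteRateGE (A.piecewise P1 P0 k) (streamLLR P0 P1 A k)
      (A.piecewise I J k))
    {α β : ℝ} (hα : 0 < α) (hβ : 0 < β) (C : Set (Finset (Fin K))) (hW : ∀ k, k ∈ W k) :
    leadProcedure P0 P1 C (Real.log (2 ^ K / α)) (Real.log (2 ^ K / β)) W ∈
      controlled P0 P1 α β C := by
  intro B hB
  have hT := ae_leadProcedure_T_ne_top hI hJ (hcomp B) hB (Real.log (2 ^ K / α))
    (Real.log (2 ^ K / β)) W
  refine ⟨hT, (measure_mono ?_).trans (jointLaw_exists_exists_le_jointLLR hequiv B hα),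
    (measure_mono_ae ?_).trans (jointLaw_exists_exists_le_jointLLR hequiv B hβ)⟩
  · rintro ω ⟨k, hk, hD⟩
    exact exists_le_jointLLR_of_leadProcedure_D_eq_true (hW k) hB hk hD
  · filter_upwards [ae_all_iff.2 hT] with ω hω
    rintro ⟨k, hk, hD⟩
    exact exists_le_jointLLR_of_leadProcedure_D_eq_false (hW k) hB hk (hω k) hD

end Leaders

section Levels

variable {ι : Type*} {F : Filter ι} {γ w : ι → ℝ} {r : ℝ}

theorem tendsto_abs_log_atTop (hγ : Tendsto γ F (𝓝[>] 0)) :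
    Tendsto (fun x => |Real.log (γ x)|) F atTop :=
  tendsto_abs_atBot_atTop.comp (Real.tendsto_log_nhdsGT_zero.comp hγ)

theorem eventually_abs_log_eq_neg_log (hγ : Tendsto γ F (𝓝[>] 0)) :
    ∀ᶠ x in F, |Real.log (γ x)| = -Real.log (γ x) := by
  filter_upwards [(Real.tendsto_log_nhdsGT_zero.comp hγ).eventually_le_atBot 0] with x hx
  exact abs_of_nonpos hx

theorem tendsto_log_const_div_div (hγ : Tendsto γ F (𝓝[>] 0)) (hw : Tendsto w F atTop)
    (hr : Tendsto (fun x => |Real.log (γ x)| / w x) F (𝓝 r)) {c : ℝ} (hc : c ≠ 0) :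
    Tendsto (fun x => Real.log (c / γ x) / w x) F (𝓝 r) := by
  have h := (hw.const_div_atTop (Real.log c)).add hr
  rw [zero_add] at h
  refine h.congr' ?_
  filter_upwards [hγ self_mem_nhdsWithin, eventually_abs_log_eq_neg_log hγ] with x hx habs
  rw [habs, Real.log_div hc (Set.mem_Ioi.1 hx).ne', ← add_div, sub_eq_add_neg]

theorem tendsto_exp_mul_level (hγ : Tendsto γ F (𝓝[>] 0)) (hw : Tendsto w F atTop)
    (hr : Tendsto (fun x => |Real.log (γ x)| / w x) F (𝓝 r)) {c : ℝ} (hc : c < r) :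
    Tendsto (fun x => ENNReal.ofReal (Real.exp (c * w x)) * ENNReal.ofReal (γ x)) F (𝓝 0) := by
  have hexponent : Tendsto (fun x => (c - |Real.log (γ x)| / w x) * w x) F atBot :=
    (tendsto_const_nhds.sub hr).neg_mul_atTop (sub_neg.2 hc) hw
  rw [← ENNReal.ofReal_zero]
  refine (ENNReal.tendsto_ofReal (Real.tendsto_exp_atBot.comp hexponent)).congr' ?_
  filter_upwards [hw.eventually_gt_atTop 0, hγ self_mem_nhdsWithin,
    eventually_abs_log_eq_neg_log hγ] with x hwx hγx habs
  rw [← ENNReal.ofReal_mul (Real.exp_pos _).le, Function.comp_apply, habs, sub_mul,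
    div_mul_cancel₀ _ hwx.ne', sub_neg_eq_add, Real.exp_add, Real.exp_log hγx]

/-- The regime in which the error levels `α` and `β` vanish with `|log α| ∼ p w` and
`|log β| ∼ q w` for a common scale `w → ∞`. -/
structure IsLogRegime (F : Filter ι) (α β w : ι → ℝ) (p q : ℝ) : Prop where
  tendsto_alpha : Tendsto α F (𝓝[>] 0)
  tendsto_beta : Tendsto β F (𝓝[>] 0)
  tendsto_scale : Tendsto w F atTop
  tendsto_log_alpha : Tendsto (fun x => |Real.log (α x)| / w x) F (𝓝 p)
  tendsto_log_beta : Tendsto (fun x => |Real.log (β x)| / w x) F (𝓝 q)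

variable {α β : ι → ℝ} {p q : ℝ}

theorem IsLogRegime.tendsto_level (h : IsLogRegime F α β w p q) (s : Prop) [Decidable s] :
    Tendsto (fun x => if s then α x else β x) F (𝓝[>] 0) := by
  split_ifs
  exacts [h.tendsto_alpha, h.tendsto_beta]

theorem IsLogRegime.tendsto_log_level (h : IsLogRegime F α β w p q) (s : Prop) [Decidable s] :
    Tendsto (fun x => |Real.log (if s then α x else β x)| / w x) F (𝓝 (if s then p else q)) := by
  split_ifs
  exacts [h.tendsto_log_alpha, h.tendsto_log_beta]

theorem tendsto_abs_log_div_self (hγ : Tendsto γ F (𝓝[>] 0)) :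
    Tendsto (fun x => |Real.log (γ x)| / |Real.log (γ x)|) F (𝓝 1) := by
  refine tendsto_const_nhds.congr' ?_
  filter_upwards [(tendsto_abs_log_atTop hγ).eventually_gt_atTop 0] with x hx
  exact (div_self hx.ne').symm

theorem isLogRegime_abs_log_beta (hα : Tendsto α F (𝓝[>] 0)) (hβ : Tendsto β F (𝓝[>] 0))
    (h : Tendsto (fun x => |Real.log (α x)| / |Real.log (β x)|) F (𝓝 r)) :
    IsLogRegime F α β (fun x => |Real.log (β x)|) r 1 :=
  ⟨hα, hβ, tendsto_abs_log_atTop hβ, h, tendsto_abs_log_div_self hβ⟩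

theorem isLogRegime_abs_log_alpha (hα : Tendsto α F (𝓝[>] 0)) (hβ : Tendsto β F (𝓝[>] 0))
    (h : Tendsto (fun x => |Real.log (β x)| / |Real.log (α x)|) F (𝓝 r)) :
    IsLogRegime F α β (fun x => |Real.log (α x)|) 1 r :=
  ⟨hα, hβ, tendsto_abs_log_atTop hα, tendsto_abs_log_div_self hα, h⟩

end Levels

section Asymptotics

variable {K : ℕ} {E : Fin K → Type*} [∀ k, MeasurableSpace (E k)]
  {P0 P1 : (k : Fin K) → Measure (ℕ → E k)} [∀ k, IsProbabilityMeasure (P0 k)]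
  [∀ k, IsProbabilityMeasure (P1 k)] {I J : Fin K → ℝ} {C : Set (Finset (Fin K))}
  {A B : Finset (Fin K)} {k : Fin K} {ι : Type*} {F : Filter ι} {α β w : ι → ℝ} {p q : ℝ}

theorem eventually_forall_le_of_eventually_le {u : ℕ → ℝ} {c : ℝ} (hc : 0 < c)
    (h : ∀ᶠ n : ℕ in atTop, u n ≤ c * n) : ∀ᶠ N : ℕ in atTop, ∀ n ≤ N, u n ≤ c * N := by
  obtain ⟨n₀, hn₀⟩ := eventually_atTop.1 h
  obtain ⟨M, hM⟩ := ((Set.finite_lt_nat n₀).image u).bddAbove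
  have hlarge : ∀ᶠ N : ℕ in atTop, M ≤ c * N :=
    (tendsto_natCast_atTop_atTop.const_mul_atTop hc).eventually_ge_atTop M
  filter_upwards [hlarge] with N hN n hnN
  rcases lt_or_ge n n₀ with hlt | hge
  · exact (hM ⟨n, hlt, rfl⟩).trans hN
  · exact (hn₀ n hge).trans (by gcongr)

theorem tendsto_jointLaw_exists_lt_jointLLR (hI : ∀ k, 0 < I k) (hJ : ∀ k, 0 < J k)
    (hlim : ∀ k, LimsupRateLE (A.piecewise P1 P0 k) (streamLLR P0 P1 A k) (A.piecewise I J k))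
    (hk : k ∈ A ∆ B) {θ : ℝ} (hθ : 1 < θ) :
    Tendsto (fun N : ℕ => jointLaw P0 P1 A
      {ω | ∃ n ≤ N, θ * infoRate I J A B * N < jointLLR P0 P1 A B n ω}) atTop (𝓝 0) := by
  rw [← measure_empty (μ := jointLaw P0 P1 A)]
  refine tendsto_measure_of_ae_tendsto_indicator_of_isFiniteMeasure _ MeasurableSet.empty
    (fun N => ?_) ?_
  · simp only [Set.ofPred_exists]
    exact .iUnion fun n => (MeasurableSet.const _).inter
      ((obsFiltration E).le n _ (measurable_jointLLR P0 P1 A B n measurableSet_Ioi))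
  · filter_upwards [ae_eventually_jointLLR_le hI hJ hlim B hθ] with ω hω
    filter_upwards [eventually_forall_le_of_eventually_le
      (mul_pos (one_pos.trans hθ) (infoRate_pos hI hJ hk)) hω] with N hN
    simpa using hN

theorem tendsto_mul_one_sub_lowerBoundError (hI : ∀ k, 0 < I k) (hJ : ∀ k, 0 < J k)
    (hlim : ∀ k, LimsupRateLE (A.piecewise P1 P0 k) (streamLLR P0 P1 A k) (A.piecewise I J k))
    (hk : k ∈ A ∆ B) (h : IsLogRegime F α β w p q) {θ m : ℝ} (hθ : 1 < θ) (hm : 0 < m)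
    (hθm : θ * m * infoRate I J A B < if k ∈ A then p else q) :
    Tendsto (fun x => ENNReal.ofReal m * (1 - (ENNReal.ofReal (if k ∈ A then β x else α x) +
        jointLaw P0 P1 A {ω | ∃ n ≤ ⌊m * w x⌋₊,
          θ * infoRate I J A B * ⌊m * w x⌋₊ < jointLLR P0 P1 A B n ω} +
        ENNReal.ofReal (Real.exp (θ * m * infoRate I J A B * w x)) *
          ENNReal.ofReal (if k ∈ A then α x else β x)))) F (𝓝 (ENNReal.ofReal m)) := by
  have hwrong : Tendsto (fun x => if k ∈ A then β x else α x) F (𝓝 0) := by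
    refine Tendsto.mono_right ?_ (nhdsWithin_le_nhds (s := Set.Ioi 0))
    split_ifs
    exacts [h.tendsto_beta, h.tendsto_alpha]
  have hLLR := (tendsto_jointLaw_exists_lt_jointLLR hI hJ hlim hk hθ).comp
    (tendsto_nat_floor_atTop.comp (h.tendsto_scale.const_mul_atTop hm))
  have hlevel := tendsto_exp_mul_level (h.tendsto_level (k ∈ A)) h.tendsto_scale
    (h.tendsto_log_level (k ∈ A)) hθm
  have herror := ((ENNReal.tendsto_ofReal hwrong).add hLLR).add hlevel
  have hfactor := ENNReal.Tendsto.sub (tendsto_const_nhds (x := (1 : ℝ≥0∞))) herror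
    (.inl ENNReal.one_ne_top)
  simpa using ENNReal.Tendsto.const_mul hfactor (.inr ENNReal.ofReal_ne_top)

theorem eventually_lt_optTime_div (hI : ∀ k, 0 < I k) (hJ : ∀ k, 0 < J k)
    (hequiv : ∀ k, LocallyEquivalent (P0 k) (P1 k))
    (hlim : ∀ k, LimsupRateLE (A.piecewise P1 P0 k) (streamLLR P0 P1 A k) (A.piecewise I J k))
    (hA : A ∈ C) (hB : B ∈ C) (hk : k ∈ A ∆ B) (h : IsLogRegime F α β w p q) {t : ℝ≥0∞}
    (ht : t < ENNReal.ofReal (if k ∈ A then p else q) / ENNReal.ofReal (infoRate I J A B)) :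
    ∀ᶠ x in F, t < optTime P0 P1 k A (α x) (β x) C / ENNReal.ofReal (w x) := by
  have hR : 0 < infoRate I J A B := infoRate_pos hI hJ hk
  obtain ⟨m, -, htm, hmr⟩ := ENNReal.lt_iff_exists_real_btwn.1 ht
  have hm : 0 < m := ENNReal.ofReal_pos.1 (bot_le.trans_lt htm)
  obtain ⟨θ, hθ, hθm⟩ : ∃ θ, 1 < θ ∧ θ * m * infoRate I J A B < if k ∈ A then p else q := by
    rw [← ENNReal.ofReal_div_of_pos hR, ENNReal.ofReal_lt_ofReal_iff_of_nonneg hm.le] at hmr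
    obtain ⟨θ, hθ, hθr⟩ := exists_between ((one_lt_div hm).2 hmr)
    exact ⟨θ, hθ, (lt_div_iff₀ hR).1 ((lt_div_iff₀ hm).1 hθr)⟩
  filter_upwards [(tendsto_mul_one_sub_lowerBoundError hI hJ hlim hk h hθ hm
    hθm).eventually_const_lt htm, h.tendsto_scale.eventually_gt_atTop 0] with x hx hwx
  have hscale : ENNReal.ofReal (m * w x) ≤ (⌊m * w x⌋₊ + 1 : ℕ) := by
    rw [← ENNReal.ofReal_natCast]
    exact ENNReal.ofReal_le_ofReal (by exact_mod_cast (Nat.lt_floor_add_one _).le)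
  have hexponent : θ * infoRate I J A B * ⌊m * w x⌋₊ ≤ θ * m * infoRate I J A B * w x :=
    calc θ * infoRate I J A B * ⌊m * w x⌋₊
        ≤ θ * infoRate I J A B * (m * w x) := by
          gcongr
          exact Nat.floor_le (by positivity)
      _ = θ * m * infoRate I J A B * w x := by ring
  refine hx.trans_le ((ENNReal.le_div_iff_mul_le (.inl (ENNReal.ofReal_pos.2 hwx).ne')
    (.inl ENNReal.ofReal_ne_top)).2 (le_trans ?_ (mul_le_optTime hequiv hA hB hk (α x) (β x)
      ⌊m * w x⌋₊ (θ * infoRate I J A B * ⌊m * w x⌋₊))))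
  rw [mul_right_comm, ← ENNReal.ofReal_mul hm.le]
  gcongr ?_ * (1 - (_ + ENNReal.ofReal (Real.exp ?_) * _))

theorem tendsto_iSup_level_div_sepRate (hI : ∀ k, 0 < I k) (hJ : ∀ k, 0 < J k)
    (h : IsLogRegime F α β w p q) (C : Set (Finset (Fin K))) (A W : Finset (Fin K)) :
    Tendsto (fun x => (⨆ k ∈ W, ENNReal.ofReal
        (if k ∈ A then Real.log (2 ^ K / α x) else Real.log (2 ^ K / β x)) /
          sepRate I J C A k) / ENNReal.ofReal (w x)) F
      (𝓝 (⨆ k ∈ W, ENNReal.ofReal (if k ∈ A then p else q) / sepRate I J C A k)) := by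
  have hstream (k : Fin K) : Tendsto (fun x => ENNReal.ofReal
      ((if k ∈ A then Real.log (2 ^ K / α x) else Real.log (2 ^ K / β x)) / w x) /
        sepRate I J C A k) F
      (𝓝 (ENNReal.ofReal (if k ∈ A then p else q) / sepRate I J C A k)) := by
    refine ENNReal.Tendsto.div_const (ENNReal.tendsto_ofReal ?_)
      (.inr (sepRate_ne_zero hI hJ C A k))
    split_ifs
    exacts [tendsto_log_const_div_div h.tendsto_alpha h.tendsto_scale h.tendsto_log_alpha (by simp),
      tendsto_log_const_div_div h.tendsto_beta h.tendsto_scale h.tendsto_log_beta (by simp)]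
  simp only [← Finset.sup_eq_iSup]
  refine (Tendsto.finset_sup_nhds_apply fun k _ => hstream k).congr' ?_
  filter_upwards [h.tendsto_scale.eventually_gt_atTop 0] with x hx
  simp only [Finset.sup_eq_iSup, ENNReal.iSup_div, ENNReal.ofReal_div_of_pos hx,
    ENNReal.div_right_comm]

theorem eventually_expTime_leadProcedure_div_lt (hI : ∀ k, 0 < I k) (hJ : ∀ k, 0 < J k)
    (hcomp : ∀ k, CompleteRateGE (A.piecewise P1 P0 k) (streamLLR P0 P1 A k)
      (A.piecewise I J k))
    (hA : A ∈ C) (h : IsLogRegime F α β w p q) (W : Fin K → Finset (Fin K)) (k : Fin K)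
    {t : ℝ≥0∞}
    (ht : ⨆ k' ∈ W k, ENNReal.ofReal (if k' ∈ A then p else q) / sepRate I J C A k' < t) :
    ∀ᶠ x in F, expTime P0 P1 A
      (leadProcedure P0 P1 C (Real.log (2 ^ K / α x)) (Real.log (2 ^ K / β x)) W) k /
        ENNReal.ofReal (w x) < t := by
  set L : ι → ℝ≥0∞ := fun x => ⨆ k' ∈ W k, ENNReal.ofReal
    (if k' ∈ A then Real.log (2 ^ K / α x) else Real.log (2 ^ K / β x)) / sepRate I J C A k'
  set Λ : ℝ≥0∞ := ⨆ k' ∈ W k, ENNReal.ofReal (if k' ∈ A then p else q) / sepRate I J C A k'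
  have hΛ : Tendsto (fun θ : ℝ => Λ / ENNReal.ofReal θ) (𝓝[<] 1) (𝓝 Λ) := by
    have hone : Tendsto ENNReal.ofReal (𝓝[<] 1) (𝓝 1) := by
      simpa using ENNReal.tendsto_ofReal (tendsto_id.mono_left (nhdsWithin_le_nhds (a := (1 : ℝ))))
    simpa using ENNReal.Tendsto.const_div hone (.inl ENNReal.one_ne_top) (a := Λ)
  obtain ⟨θ, hθt, hθ0, hθ1⟩ :=
    ((hΛ.eventually_lt_const ht).and (Ioo_mem_nhdsLT zero_lt_one)).exists
  set S : ℝ≥0∞ := 1 + ∑' n, jointLaw P0 P1 A (lagSet P0 P1 I J A θ (n + 1))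
  have hL : Tendsto (fun x => L x / ENNReal.ofReal (w x)) F (𝓝 Λ) :=
    tendsto_iSup_level_div_sepRate hI hJ h C A (W k)
  have hS : Tendsto (fun x => S / ENNReal.ofReal (w x)) F (𝓝 0) := by
    have hS_ne_top : S ≠ ∞ := ENNReal.add_ne_top.2
      ⟨ENNReal.one_ne_top, tsum_jointLaw_lagSet_ne_top hI hJ hcomp hθ1⟩
    simpa using ENNReal.Tendsto.const_div
      (ENNReal.tendsto_ofReal_atTop.comp h.tendsto_scale) (.inr hS_ne_top)
  have hbound : Tendsto (fun x => L x / ENNReal.ofReal (w x) / ENNReal.ofReal θ +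
      S / ENNReal.ofReal (w x)) F (𝓝 (Λ / ENNReal.ofReal θ)) := by
    simpa using (ENNReal.Tendsto.div_const hL (.inr (ENNReal.ofReal_pos.2 hθ0).ne')).add hS
  filter_upwards [hbound.eventually_lt_const hθt] with x hx
  refine lt_of_le_of_lt ?_ hx
  rw [ENNReal.div_right_comm, ← ENNReal.add_div]
  gcongr
  exact (expTime_leadProcedure_le hI hJ hA _ _ W k hθ0).trans_eq (add_assoc ..)

/-- The standing assumptions on the streams: the two laws of each stream are locally equivalent, and
under each of them the log-likelihood ratio in favour of the true role grows at the positive rate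
`I k` for a signal and `J k` for a noise, completely from below. -/
structure HasRates (P0 P1 : (k : Fin K) → Measure (ℕ → E k)) (I J : Fin K → ℝ) : Prop where
  signal_pos : ∀ k, 0 < I k
  noise_pos : ∀ k, 0 < J k
  locallyEquivalent : ∀ k, LocallyEquivalent (P0 k) (P1 k)
  limsupRateLE : ∀ A k,
    LimsupRateLE (A.piecewise P1 P0 k) (streamLLR P0 P1 A k) (A.piecewise I J k)
  completeRateGE : ∀ A k,
    CompleteRateGE (A.piecewise P1 P0 k) (streamLLR P0 P1 A k) (A.piecewise I J k)

theorem eventually_lt_optTime_div_of_lt_div_sepRate (hrates : HasRates P0 P1 I J) (hA : A ∈ C)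
    (h : IsLogRegime F α β w p q) {t : ℝ≥0∞}
    (ht : t < ENNReal.ofReal (if k ∈ A then p else q) / sepRate I J C A k) :
    ∀ᶠ x in F, t < optTime P0 P1 k A (α x) (β x) C / ENNReal.ofReal (w x) := by
  simp only [sepRate, div_eq_mul_inv, ENNReal.inv_iInf, ENNReal.mul_iSup, lt_iSup_iff] at ht
  obtain ⟨B, hB, hk, htB⟩ := ht
  exact eventually_lt_optTime_div hrates.signal_pos hrates.noise_pos hrates.locallyEquivalent
    (hrates.limsupRateLE A) hA hB hk h htB

theorem tendsto_optTime_div (hrates : HasRates P0 P1 I J) (hA : A ∈ C)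
    (h : IsLogRegime F α β w p q) (k : Fin K) :
    Tendsto (fun x => optTime P0 P1 k A (α x) (β x) C / ENNReal.ofReal (w x)) F
      (𝓝 (ENNReal.ofReal (if k ∈ A then p else q) / sepRate I J C A k)) := by
  refine tendsto_order.2 ⟨fun t ht => eventually_lt_optTime_div_of_lt_div_sepRate hrates hA h ht,
    fun t ht => ?_⟩
  have hlead := eventually_expTime_leadProcedure_div_lt hrates.signal_pos hrates.noise_pos
    (hrates.completeRateGE A) hA h (fun k => {k}) k (t := t) (by simpa using ht)
  filter_upwards [hlead, h.tendsto_alpha self_mem_nhdsWithin,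
    h.tendsto_beta self_mem_nhdsWithin] with x hx hα hβ
  refine lt_of_le_of_lt ?_ hx
  gcongr
  exact iInf₂_le _ (leadProcedure_mem_controlled hrates.signal_pos hrates.noise_pos
    hrates.locallyEquivalent hrates.completeRateGE hα hβ C fun k => Finset.mem_singleton_self k)

theorem tendsto_optTimeSync_div [NeZero K] (hrates : HasRates P0 P1 I J) (hA : A ∈ C)
    (h : IsLogRegime F α β w p q) :
    Tendsto (fun x => optTimeSync P0 P1 A (α x) (β x) C / ENNReal.ofReal (w x)) F
      (𝓝 (⨆ k, ENNReal.ofReal (if k ∈ A then p else q) / sepRate I J C A k)) := by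
  refine tendsto_order.2 ⟨fun t ht => ?_, fun t ht => ?_⟩
  · obtain ⟨k, hk⟩ := lt_iSup_iff.1 ht
    filter_upwards [eventually_lt_optTime_div_of_lt_div_sepRate hrates hA h hk] with x hx
    exact hx.trans_le (ENNReal.div_le_div_right (optTime_le_optTimeSync P0 P1 k A _ _ C) _)
  · have hlead := eventually_expTime_leadProcedure_div_lt hrates.signal_pos hrates.noise_pos
      (hrates.completeRateGE A) hA h (fun _ => Finset.univ) 0 (t := t) (by simpa using ht)
    filter_upwards [hlead, h.tendsto_alpha self_mem_nhdsWithin,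
      h.tendsto_beta self_mem_nhdsWithin] with x hx hα hβ
    refine lt_of_le_of_lt ?_ hx
    gcongr
    exact iInf₂_le _ ⟨leadProcedure_mem_controlled hrates.signal_pos hrates.noise_pos
      hrates.locallyEquivalent hrates.completeRateGE hα hβ C fun k => Finset.mem_univ k,
      fun _ _ => rfl⟩

end Asymptotics

section RelativeEfficiency

variable {K : ℕ} {E : Fin K → Type*} [∀ k, MeasurableSpace (E k)]
  {P0 P1 : (k : Fin K) → Measure (ℕ → E k)} [∀ k, IsProbabilityMeasure (P0 k)]
  [∀ k, IsProbabilityMeasure (P1 k)] {I J : Fin K → ℝ} {C : Set (Finset (Fin K))}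
  {A : Finset (Fin K)} {ι : Type*} {F : Filter ι} {α β w : ι → ℝ} {p q : ℝ}

theorem tendsto_optTime_div_optTimeSync [NeZero K] (hrates : HasRates P0 P1 I J) (hA : A ∈ C)
    (h : IsLogRegime F α β w p q)
    (hne : ∃ k, 0 < (if k ∈ A then p else q) ∧ sepRate I J C A k ≠ ∞) (k : Fin K) :
    Tendsto (fun x => optTime P0 P1 k A (α x) (β x) C / optTimeSync P0 P1 A (α x) (β x) C) F
      (𝓝 (ENNReal.ofReal (if k ∈ A then p else q) / sepRate I J C A k /
        ⨆ k', ENNReal.ofReal (if k' ∈ A then p else q) / sepRate I J C A k')) := by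
  have hsync : ⨆ k', ENNReal.ofReal (if k' ∈ A then p else q) / sepRate I J C A k' ≠ 0 := by
    obtain ⟨k₀, hlevel, hsep⟩ := hne
    exact ((ENNReal.div_pos (ENNReal.ofReal_pos.2 hlevel).ne' hsep).trans_le
      (le_iSup (fun k' => ENNReal.ofReal (if k' ∈ A then p else q) / _) k₀)).ne'
  refine (ENNReal.Tendsto.div (tendsto_optTime_div hrates hA h k) (.inr hsync)
    (tendsto_optTimeSync_div hrates hA h) (.inr (ENNReal.div_ne_top ENNReal.ofReal_ne_top
      (sepRate_ne_zero hrates.signal_pos hrates.noise_pos C A k)))).congr' ?_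
  filter_upwards [h.tendsto_scale.eventually_gt_atTop 0] with x hx
  exact ENNReal.mul_div_mul_right _ _ (ENNReal.inv_ne_zero.2 ENNReal.ofReal_ne_top)
    (ENNReal.inv_ne_top.2 (ENNReal.ofReal_pos.2 hx).ne')

end RelativeEfficiency

theorem ennreal_inv_div_inv (x y : ℝ≥0∞) : x⁻¹ / y⁻¹ = y / x := by
  rw [div_eq_mul_inv, inv_inv, mul_comm, div_eq_mul_inv]

section SizeClass

variable {K l u : ℕ} {I J : Fin K → ℝ} {A B : Finset (Fin K)} {i j k : Fin K}

theorem signalRate_le_infoRate (hI : ∀ k, 0 < I k) (hJ : ∀ k, 0 < J k) (hB : l ≤ B.card)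
    (hiA : i ∈ A) (hiB : i ∉ B) :
    signalRate J l A (ENNReal.ofReal (I i)) ≤ ENNReal.ofReal (infoRate I J A B) := by
  have hi : i ∈ A ∆ B := Finset.mem_symmDiff.2 (.inl ⟨hiA, hiB⟩)
  have hpos (k : Fin K) : 0 ≤ A.piecewise I J k := (piecewise_pos hI hJ A k).le
  unfold signalRate
  split_ifs with hcard
  · obtain ⟨j, hjB, hjA⟩ : ∃ j ∈ B, j ∉ A := Finset.not_subset.1 fun hBA =>
      hiB (Finset.eq_of_subset_of_card_le hBA (hcard.trans_le hB) ▸ hiA)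
    have hj : j ∈ A ∆ B := Finset.mem_symmDiff.2 (.inr ⟨hjB, hjA⟩)
    calc ENNReal.ofReal (I i) + minOver J Aᶜ
        ≤ ENNReal.ofReal (I i) + ENNReal.ofReal (J j) := by
          gcongr
          exact iInf₂_le j (Finset.mem_compl.2 hjA)
      _ = ENNReal.ofReal (∑ k ∈ {i, j}, A.piecewise I J k) := by
          rw [← ENNReal.ofReal_add (hI i).le (hJ j).le,
            Finset.sum_pair (ne_of_mem_of_not_mem hiA hjA),
            Finset.piecewise_eq_of_mem _ _ _ hiA, Finset.piecewise_eq_of_notMem _ _ _ hjA]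
      _ ≤ ENNReal.ofReal (infoRate I J A B) := ENNReal.ofReal_le_ofReal <|
          Finset.sum_le_sum_of_subset_of_nonneg (by grind) fun k _ _ => hpos k
  · rw [add_zero, ← Finset.piecewise_eq_of_mem A I J hiA]
    exact ENNReal.ofReal_le_ofReal (Finset.single_le_sum (fun k _ => hpos k) hi)

theorem infoRate_erase (hi : i ∈ A) : infoRate I J A (A.erase i) = I i := by
  have hdiff : A ∆ A.erase i = {i} := by grind [Finset.mem_symmDiff]
  rw [infoRate, hdiff, Finset.sum_singleton, Finset.piecewise_eq_of_mem _ _ _ hi]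

theorem infoRate_insert_erase (hi : i ∈ A) (hj : j ∉ A) :
    infoRate I J A (insert j (A.erase i)) = I i + J j := by
  have hdiff : A ∆ insert j (A.erase i) = {i, j} := by grind [Finset.mem_symmDiff]
  rw [infoRate, hdiff, Finset.sum_pair (ne_of_mem_of_not_mem hi hj),
    Finset.piecewise_eq_of_mem _ _ _ hi, Finset.piecewise_eq_of_notMem _ _ _ hj]

/- The least informative alternatives that turn the signal `i` into a noise are the removal of `i`
and, when there are no signals to spare, its exchange with a noise. -/
theorem sepRate_sizeClass_of_mem (hI : ∀ k, 0 < I k) (hJ : ∀ k, 0 < J k)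
    (hA : A ∈ sizeClass K l u) (hi : i ∈ A) :
    sepRate I J (sizeClass K l u) A i = signalRate J l A (ENNReal.ofReal (I i)) := by
  refine le_antisymm ?_ (le_iInf₂ fun B hB => le_iInf fun hk =>
    signalRate_le_infoRate hI hJ hB.1 hi (by grind [Finset.mem_symmDiff]))
  obtain ⟨hlA, hAu⟩ := hA
  have hcard := Finset.card_erase_add_one hi
  unfold signalRate
  split_ifs with hAl
  · simp only [minOver, ENNReal.add_iInf]
    refine le_iInf₂ fun j hj => ?_
    have hjA : j ∉ A := Finset.mem_compl.1 hj
    rw [← ENNReal.ofReal_add (hI i).le (hJ j).le, ← infoRate_insert_erase hi hjA]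
    refine sepRate_le_infoRate ?_ (by grind [Finset.mem_symmDiff])
    rw [sizeClass, Set.mem_ofPred_eq, Finset.card_insert_of_notMem (by grind), hcard]
    exact ⟨hlA, hAu⟩
  · rw [add_zero, ← infoRate_erase (I := I) (J := J) hi]
    exact sepRate_le_infoRate ⟨by omega, by omega⟩ (by grind [Finset.mem_symmDiff])

theorem infoRate_compl (I J : Fin K → ℝ) (A B : Finset (Fin K)) :
    infoRate J I Aᶜ Bᶜ = infoRate I J A B := by
  rw [infoRate, compl_symmDiff_compl, Finset.piecewise_compl, infoRate]

theorem compl_mem_sizeClass_iff (hl : l ≤ K) (hu : u ≤ K) :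
    Aᶜ ∈ sizeClass K (K - u) (K - l) ↔ A ∈ sizeClass K l u := by
  have hcard := A.card_le_univ
  simp only [sizeClass, Set.mem_ofPred_eq, Finset.card_compl, Fintype.card_fin] at hcard ⊢
  omega

theorem sepRate_sizeClass_compl (hl : l ≤ K) (hu : u ≤ K) (I J : Fin K → ℝ)
    (A : Finset (Fin K)) (k : Fin K) :
    sepRate J I (sizeClass K (K - u) (K - l)) Aᶜ k = sepRate I J (sizeClass K l u) A k := by
  rw [sepRate, ← compl_surjective.iInf_comp]
  simp only [compl_mem_sizeClass_iff hl hu, compl_symmDiff_compl, infoRate_compl, sepRate]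

theorem signalRate_compl (hu : u ≤ K) (I : Fin K → ℝ) (A : Finset (Fin K)) (x : ℝ≥0∞) :
    signalRate I (K - u) Aᶜ x = noiseRate I u A x := by
  have hcard : Aᶜ.card = K - u ↔ A.card = u := by
    have := A.card_le_univ
    simp only [Finset.card_compl, Fintype.card_fin] at this ⊢
    omega
  simp only [signalRate, noiseRate, hcard, compl_compl]

theorem sepRate_sizeClass_of_notMem (hI : ∀ k, 0 < I k) (hJ : ∀ k, 0 < J k) (hu : u ≤ K)
    (hA : A ∈ sizeClass K l u) (hj : j ∉ A) :
    sepRate I J (sizeClass K l u) A j = noiseRate I u A (ENNReal.ofReal (J j)) := by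
  have hl : l ≤ K := hA.1.trans (hA.2.trans hu)
  rw [← sepRate_sizeClass_compl hl hu, ← signalRate_compl hu]
  exact sepRate_sizeClass_of_mem hJ hI ((compl_mem_sizeClass_iff hl hu).2 hA)
    (Finset.mem_compl.2 hj)

theorem div_minOver_add (f : Fin K → ℝ) (s : Finset (Fin K)) (c d : ℝ≥0∞) :
    c / (minOver f s + d) = ⨆ k ∈ s, c / (ENNReal.ofReal (f k) + d) := by
  simp only [minOver, ENNReal.iInf_add, div_eq_mul_inv, ENNReal.inv_iInf, ENNReal.mul_iSup]

theorem iSup_div_sepRate_sizeClass (hI : ∀ k, 0 < I k) (hJ : ∀ k, 0 < J k) (hu : u ≤ K)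
    (hA : A ∈ sizeClass K l u) (p q : ℝ) :
    ⨆ k, ENNReal.ofReal (if k ∈ A then p else q) / sepRate I J (sizeClass K l u) A k =
      max (ENNReal.ofReal p / signalRate J l A (minOver I A))
        (ENNReal.ofReal q / noiseRate I u A (minOver J Aᶜ)) := by
  rw [iSup_split _ (· ∈ A), signalRate, noiseRate, div_minOver_add, div_minOver_add]
  congr 1
  · exact biSup_congr fun i hi => by
      rw [if_pos hi, sepRate_sizeClass_of_mem hI hJ hA hi, signalRate]
  · simp only [Finset.mem_compl]
    exact biSup_congr fun j hj => by
      rw [if_neg hj, sepRate_sizeClass_of_notMem hI hJ hu hA hj, noiseRate]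

theorem minOver_ne_top {s : Finset (Fin K)} (hs : s.Nonempty) (f : Fin K → ℝ) :
    minOver f s ≠ ∞ := by
  obtain ⟨k, hk⟩ := hs
  exact ne_top_of_le_ne_top ENNReal.ofReal_ne_top (iInf₂_le k hk)

theorem signalRate_ne_top (hl : l < K) (J : Fin K → ℝ) (A : Finset (Fin K)) {x : ℝ≥0∞}
    (hx : x ≠ ∞) : signalRate J l A x ≠ ∞ := by
  refine ENNReal.add_ne_top.2 ⟨hx, ?_⟩
  split_ifs with hcard
  · refine minOver_ne_top (Finset.card_pos.1 ?_) J
    rw [Finset.card_compl, hcard, Fintype.card_fin]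
    exact Nat.sub_pos_of_lt hl
  · exact ENNReal.zero_ne_top

theorem noiseRate_ne_top (hu : 0 < u) (I : Fin K → ℝ) (A : Finset (Fin K)) {x : ℝ≥0∞}
    (hx : x ≠ ∞) : noiseRate I u A x ≠ ∞ := by
  refine ENNReal.add_ne_top.2 ⟨hx, ?_⟩
  split_ifs with hcard
  · exact minOver_ne_top (Finset.card_pos.1 (hcard ▸ hu)) I
  · exact ENNReal.zero_ne_top

theorem sepRate_sizeClass_ne_top (hI : ∀ k, 0 < I k) (hJ : ∀ k, 0 < J k) (huK : u ≤ K)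
    (hu : 0 < u) (hl : l < K) (hA : A ∈ sizeClass K l u) (k : Fin K) :
    sepRate I J (sizeClass K l u) A k ≠ ∞ := by
  by_cases hk : k ∈ A
  · exact sepRate_sizeClass_of_mem hI hJ hA hk ▸ signalRate_ne_top hl J A ENNReal.ofReal_ne_top
  · exact sepRate_sizeClass_of_notMem hI hJ huK hA hk ▸
      noiseRate_ne_top hu I A ENNReal.ofReal_ne_top

variable [NeZero K] {E : Fin K → Type*} [∀ k, MeasurableSpace (E k)]
  {P0 P1 : (k : Fin K) → Measure (ℕ → E k)} [∀ k, IsProbabilityMeasure (P0 k)]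
  [∀ k, IsProbabilityMeasure (P1 k)] {ι : Type*} {F : Filter ι} {α β w : ι → ℝ} {p q : ℝ}

theorem tendsto_relEffSync (hrates : HasRates P0 P1 I J) (huK : u ≤ K) (hu : 0 < u) (hl : l < K)
    (hA : A ∈ sizeClass K l u) (h : IsLogRegime F α β w p q)
    (hlevel : ∃ k, 0 < if k ∈ A then p else q) (k : Fin K) :
    Tendsto (fun x => relEffSync P0 P1 l u k A (α x) (β x)) F
      (𝓝 (ENNReal.ofReal (if k ∈ A then p else q) / sepRate I J (sizeClass K l u) A k /
        max (ENNReal.ofReal p / signalRate J l A (minOver I A))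
          (ENNReal.ofReal q / noiseRate I u A (minOver J Aᶜ)))) := by
  have hI := hrates.signal_pos
  have hJ := hrates.noise_pos
  rw [← iSup_div_sepRate_sizeClass hI hJ huK hA]
  exact tendsto_optTime_div_optTimeSync hrates hA h (hlevel.imp fun k hk =>
    ⟨hk, sepRate_sizeClass_ne_top hI hJ huK hu hl hA k⟩) k

theorem tendsto_relEffSync_of_mem (hrates : HasRates P0 P1 I J) (huK : u ≤ K) (hu : 0 < u)
    (hl : l < K) (hA : A ∈ sizeClass K l u) (h : IsLogRegime F α β w p q)
    (hlevel : ∃ k, 0 < if k ∈ A then p else q) (hi : i ∈ A) :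
    Tendsto (fun x => relEffSync P0 P1 l u i A (α x) (β x)) F
      (𝓝 (ENNReal.ofReal p / signalRate J l A (ENNReal.ofReal (I i)) /
        max (ENNReal.ofReal p / signalRate J l A (minOver I A))
          (ENNReal.ofReal q / noiseRate I u A (minOver J Aᶜ)))) := by
  simpa only [if_pos hi, sepRate_sizeClass_of_mem hrates.signal_pos hrates.noise_pos hA hi]
    using tendsto_relEffSync hrates huK hu hl hA h hlevel i

theorem tendsto_relEffSync_of_notMem (hrates : HasRates P0 P1 I J) (huK : u ≤ K) (hu : 0 < u)
    (hl : l < K) (hA : A ∈ sizeClass K l u) (h : IsLogRegime F α β w p q)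
    (hlevel : ∃ k, 0 < if k ∈ A then p else q) (hj : j ∉ A) :
    Tendsto (fun x => relEffSync P0 P1 l u j A (α x) (β x)) F
      (𝓝 (ENNReal.ofReal q / noiseRate I u A (ENNReal.ofReal (J j)) /
        max (ENNReal.ofReal p / signalRate J l A (minOver I A))
          (ENNReal.ofReal q / noiseRate I u A (minOver J Aᶜ)))) := by
  simpa only [if_neg hj, sepRate_sizeClass_of_notMem hrates.signal_pos hrates.noise_pos huK hA hj]
    using tendsto_relEffSync hrates huK hu hl hA h hlevel j

end SizeClass

end SeqMultTest

theorem corollary4p3 {K : ℕ} [NeZero K] {E : Fin K → Type*} [∀ k, MeasurableSpace (E k)]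
    (P0 P1 : (k : Fin K) → Measure (ℕ → E k))
    [∀ k, IsProbabilityMeasure (P0 k)] [∀ k, IsProbabilityMeasure (P1 k)]
    (I J : Fin K → ℝ) (hI : ∀ k, 0 < I k) (hJ : ∀ k, 0 < J k)
    (hequiv : ∀ k, SeqMultTest.LocallyEquivalent (P0 k) (P1 k))
    (hlim1 : ∀ k, SeqMultTest.LimsupRateLE (P1 k)
      (SeqMultTest.logLR (P0 k) (P1 k)) (I k))
    (hlim0 : ∀ k, SeqMultTest.LimsupRateLE (P0 k)
      (fun n x => -SeqMultTest.logLR (P0 k) (P1 k) n x) (J k))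
    (hcomp1 : ∀ k, SeqMultTest.CompleteRateGE (P1 k)
      (SeqMultTest.logLR (P0 k) (P1 k)) (I k))
    (hcomp0 : ∀ k, SeqMultTest.CompleteRateGE (P0 k)
      (fun n x => -SeqMultTest.logLR (P0 k) (P1 k) n x) (J k))
    (l u : ℕ) (hlu : l ≤ u) (huK : u ≤ K) (hu : 0 < u) (hl : l < K)
    (A : Finset (Fin K)) (hA : A ∈ SeqMultTest.sizeClass K l u)
    {ι : Type*} (F : Filter ι) (α β : ι → ℝ)
    (hα : Tendsto α F (𝓝[>] 0)) (hβ : Tendsto β F (𝓝[>] 0)) :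
    -- (i) |log α| ≪ |log β|
    (Tendsto (fun x => |Real.log (α x)| / |Real.log (β x)|) F (𝓝 0) →
      (∀ i ∈ A, A ≠ Finset.univ →
        Tendsto (fun x => SeqMultTest.relEffSync P0 P1 l u i A (α x) (β x)) F (𝓝 0)) ∧
      (∀ j ∉ A,
        Tendsto (fun x => SeqMultTest.relEffSync P0 P1 l u j A (α x) (β x)) F
          (𝓝 (SeqMultTest.noiseRate I u A (SeqMultTest.minOver J Aᶜ) /
            SeqMultTest.noiseRate I u A (ENNReal.ofReal (J j)))))) ∧
    -- (ii) |log α| ≫ |log β|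
    (Tendsto (fun x => |Real.log (β x)| / |Real.log (α x)|) F (𝓝 0) →
      (∀ i ∈ A,
        Tendsto (fun x => SeqMultTest.relEffSync P0 P1 l u i A (α x) (β x)) F
          (𝓝 (SeqMultTest.signalRate J l A (SeqMultTest.minOver I A) /
            SeqMultTest.signalRate J l A (ENNReal.ofReal (I i))))) ∧
      (∀ j ∉ A, A ≠ ∅ →
        Tendsto (fun x => SeqMultTest.relEffSync P0 P1 l u j A (α x) (β x)) F (𝓝 0))) ∧
    -- (iii) |log α| ∼ r |log β|
    (∀ r : ℝ, 0 < r →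
      Tendsto (fun x => |Real.log (α x)| / (r * |Real.log (β x)|)) F (𝓝 1) →
      (∀ i ∈ A,
        Tendsto (fun x => SeqMultTest.relEffSync P0 P1 l u i A (α x) (β x)) F
          (𝓝 ((ENNReal.ofReal r / SeqMultTest.signalRate J l A (ENNReal.ofReal (I i))) /
            max (ENNReal.ofReal r / SeqMultTest.signalRate J l A (SeqMultTest.minOver I A))
              (1 / SeqMultTest.noiseRate I u A (SeqMultTest.minOver J Aᶜ))))) ∧
      (∀ j ∉ A,
        Tendsto (fun x => SeqMultTest.relEffSync P0 P1 l u j A (α x) (β x)) F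
          (𝓝 ((1 / SeqMultTest.noiseRate I u A (ENNReal.ofReal (J j))) /
            max (ENNReal.ofReal r / SeqMultTest.signalRate J l A (SeqMultTest.minOver I A))
              (1 / SeqMultTest.noiseRate I u A (SeqMultTest.minOver J Aᶜ)))))) := by
  have hrates : SeqMultTest.HasRates P0 P1 I J := ⟨hI, hJ, hequiv,
    SeqMultTest.limsupRateLE_streamLLR hlim1 hlim0,
    SeqMultTest.completeRateGE_streamLLR hcomp1 hcomp0⟩
  have hmem {w : ι → ℝ} {p q : ℝ} (h : SeqMultTest.IsLogRegime F α β w p q) {k : Fin K} :=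
    SeqMultTest.tendsto_relEffSync_of_mem hrates huK hu hl hA h (i := k)
  have hnotMem {w : ι → ℝ} {p q : ℝ} (h : SeqMultTest.IsLogRegime F α β w p q) {k : Fin K} :=
    SeqMultTest.tendsto_relEffSync_of_notMem hrates huK hu hl hA h (j := k)
  refine ⟨fun h => ?_, fun h => ?_, fun r hr h => ?_⟩
  · have hreg := SeqMultTest.isLogRegime_abs_log_beta hα hβ h
    refine ⟨fun i hi hne => ?_, fun j hj => ?_⟩
    · obtain ⟨j, hj⟩ := not_forall.1 (mt Finset.eq_univ_iff_forall.2 hne)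
      simpa using hmem hreg ⟨j, by simp [hj]⟩ hi
    · simpa [SeqMultTest.ennreal_inv_div_inv] using hnotMem hreg ⟨j, by simp [hj]⟩ hj
  · have hreg := SeqMultTest.isLogRegime_abs_log_alpha hα hβ h
    refine ⟨fun i hi => ?_, fun j hj hne => ?_⟩
    · simpa [SeqMultTest.ennreal_inv_div_inv] using hmem hreg ⟨i, by simp [hi]⟩ hi
    · obtain ⟨i, hi⟩ := Finset.nonempty_iff_ne_empty.2 hne
      simpa using hnotMem hreg ⟨i, by simp [hi]⟩ hj
  · have hratio : Tendsto (fun x => |Real.log (α x)| / |Real.log (β x)|) F (𝓝 r) := by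
      simpa [← mul_div_assoc, mul_div_mul_left _ _ hr.ne'] using h.const_mul r
    have hreg := SeqMultTest.isLogRegime_abs_log_beta hα hβ hratio
    have hlevel (k : Fin K) : 0 < if k ∈ A then r else 1 := by split_ifs <;> positivity
    exact ⟨fun i hi => by simpa using hmem hreg ⟨i, hlevel i⟩ hi,
      fun j hj => by simpa using hnotMem hreg ⟨j, hlevel j⟩ hj⟩
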